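/- For a Lebesgue measurable set $E\subset\mathbb R^2$ of finite positive area $|E|$ let $r=r(E)>0$ be given by $|E|=\pi r^2$, and let $B_r(z)$ be the closed disc of radius $r$ and centre $z$. Let $P$ denote the perimeter, $P(E)=\sup\{\int_E \operatorname{div}\varphi\,dx:\varphi\in C^1_c(\mathbb R^2;\mathbb R^2),\ |\varphi|\le 1\}$, and set $$D(E)=\frac{P(E)-P(B_r(0))}{P(B_r(0))},\qquad \lambda_{\mathcal H}(E)=\inf_{z\in\mathbb R^2}\frac{d_{\mathcal H}(E,B_r(z))}{r},\qquad \mathcal F(E)=\frac{D(E)}{\lambda_{\mathcal H}(E)^2},$$ where $d_{\mathcal H}$ is the Hausdorff distance (the infimum is attained when $E$ is bounded). For $R>0$ let $\mathcal K_R^1$ be the class of closed convex sets $E\subset\mathbb R^2$ with $|E|=\pi$ such that for every $x\in\partial E$ there is a unit vector $\nu_x$ with $$\{y\in\mathbb R^2:\ |y-x|<R,\ \langle y-x,\nu_x\rangle>\cos(\pi/4)\,|y-x|\}\subset E .$$ **Theorem.** There exists $\overline R>0$ such that for every $R$ with $0<R<\overline R$ there is a set $E_0\in\mathcal K_R^1$,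 not a disc, such that $\mathcal F(E_0)\le\mathcal F(E)$ for every $E\in\mathcal K_R^1$ that is not a disc. -/

import Mathlib

open MeasureTheory Metric

noncomputable section

namespace ConeIsop

/-- The Euclidean plane. -/
abbrev Plane : Type := EuclideanSpace ℝ (Fin 2)

/-- The radius `r` of a disc having the same area as `E`, i.e. `|E| = π r ^ 2`
(meaningful for sets of finite area). -/
def areaRadius (E : Set Plane) : ℝ :=
  Real.sqrt ((volume E).toReal / Real.pi)

/-- The open circular sector with vertex `x`, axis direction `ν`, radius `R` and aperture `θ`. -/
def sector (x ν : Plane) (R θ : ℝ) : Set Plane :=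
  {y | ‖y - x‖ < R ∧ Real.cos (θ / 2) * ‖y - x‖ < inner ℝ (y - x) ν}

/-- The interior cone condition at the boundary, with radius `R` and aperture `θ`. -/
def InteriorCone (E : Set Plane) (R θ : ℝ) : Prop :=
  ∀ x ∈ frontier E, ∃ ν : Plane, ‖ν‖ = 1 ∧ sector x ν R θ ⊆ E

/-- The scale invariant family `𝒞_R`: closed sets of finite area satisfying the interior cone
condition with radius `R` times the area radius and aperture `π / 2`. -/
def coneClass (R : ℝ) : Set (Set Plane) :=
  {E | IsClosed E ∧ volume E < ⊤ ∧ InteriorCone E (R * areaRadius E) (Real.pi / 2)}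

/-- The class `𝒦_R^1`: convex members of `𝒞_R` whose area is that of the unit disc. -/
def convexConeClass (R : ℝ) : Set (Set Plane) :=
  {E | E ∈ coneClass R ∧ Convex ℝ E ∧ volume E = ENNReal.ofReal Real.pi}

/-- The divergence of a vector field on the plane. -/
def divergence (φ : Plane → Plane) (x : Plane) : ℝ :=
  ∑ i : Fin 2, fderiv ℝ φ x (EuclideanSpace.single i 1) i

/-- The (De Giorgi) perimeter of a set: the supremum of `∫_E div φ` over compactly supported
`C¹` vector fields `φ` with `|φ| ≤ 1`. The zero field is admissible, so only nonnegative
values of the integral matter. -/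
def perimeter (E : Set Plane) : ENNReal :=
  ⨆ (φ : Plane → Plane) (_ : ContDiff ℝ 1 φ) (_ : HasCompactSupport φ) (_ : ∀ x, ‖φ x‖ ≤ 1),
    ENNReal.ofReal (∫ x in E, divergence φ x)

/-- The isoperimetric deficit `D(E) = (P(E) - P(B_r)) / P(B_r)`, where `|B_r| = |E|`.
It is extended real valued, since the perimeter may be infinite. -/
def deficit (E : Set Plane) : EReal :=
  ((perimeter E : EReal) - (perimeter (closedBall 0 (areaRadius E)) : EReal)) /
    (perimeter (closedBall 0 (areaRadius E)) : EReal)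

/-- The deviation from the spherical shape: the least value of `d_H(E, B_r(z)) / r` over all
centres `z`, where `|B_r| = |E|`. -/
def hausdorffAsymmetry (E : Set Plane) : ENNReal :=
  ⨅ z : Plane, hausdorffEDist E (closedBall z (areaRadius E)) / ENNReal.ofReal (areaRadius E)

/-- The shape functional `D(E) / λ_H(E) ^ 2`. -/
def shapeFunctional (E : Set Plane) : EReal :=
  deficit E / ((hausdorffAsymmetry E ^ 2 : ENNReal) : EReal)

/-- `E` is a (closed) ball. -/
def IsBall (E : Set Plane) : Prop :=
  ∃ (z : Plane) (r : ℝ), E = closedBall z r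

end ConeIsop

end

/-!
Existence of an optimal set for the deficit/asymmetry quotient `D / λ_H ^ 2` among convex sets
satisfying an interior cone condition.

All competitors have area `π`. By `shapeFunctional_le_iff`, the quotient of such a set with
asymmetry `l` is at most `c` exactly when its perimeter is at most `2 π (1 + c l ^ 2)`. The proof is
the direct method; the only way in which a minimising sequence can lose its limit is by converging
to a disc, and this is excluded as follows.

* Stability (`hausdorffEDist_barycenter_le`): near a disc the quotient is at least `1 / 625`. The
  perimeter is a supremum over vector fields, and for a convex set whose projection to the direction
  `e` is `[μ - τ, μ + τ]` one may test with the unit field `k(s) e ± √(1 - k(s) ^ 2) f`, where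
  `s = ⟨x, e⟩` and the sign jumps across a line inside the set (`le_perimeter_of_abs_le_one`). The
  affine profile `k` gives `P ≥ π (τ + 1 / τ)`, which controls the width. Perturbing the profile by
  `ε (1 - s ^ 2)` produces a term linear in the offset of the barycentre from the midpoint of the
  projection, at a cost quadratic in `ε`, and so controls this offset as well. Both together bound
  the support function, in every direction, by that of the unit disc about the barycentre up to a
  multiple of the square root of the deficit.
* A thin rectangle has a quotient of at most `1 / 625` (`shapeFunctional_thin_rect_le`), because the
  quotient tends to zero for elongated sets. It satisfies the cone condition as soon as `R` is at
  most half its short side, which is how the bound on `R` is chosen.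

So either the rectangle is optimal or a minimising sequence keeps its asymmetry at least `1`. In the
second case the cone condition provides a disc of radius `R / 16` inside each set, convexity and the
area then bound the diameter (`subset_closedBall_of_ball_subset`), and Blaschke's selection theorem
applies after a translation. Area and asymmetry pass to the limit, the cone condition is closed, and
the perimeter is lower semicontinuous (`exists_limit_mem_convexConeClass`).

The upper bounds for perimeters, of the disc and of the rectangle, come from comparison with the
area of neighbourhoods (`perimeter_le_of_volume_cthickening_le`).
-/

namespace ConeIsop

open Filter Topology

/-! ### Divergence and perimeter -/

theorem divergence_eq (φ : Plane → Plane) (x : Plane) :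
    divergence φ x = ∑ i : Fin 2,
      EuclideanSpace.proj (𝕜 := ℝ) i (fderiv ℝ φ x (EuclideanSpace.single i 1)) := rfl

theorem continuous_divergence {φ : Plane → Plane} (hφ : ContDiff ℝ 1 φ) :
    Continuous (divergence φ) := by
  have h := hφ.continuous_fderiv one_ne_zero
  simp_rw [funext (divergence_eq φ)]
  fun_prop

theorem hasCompactSupport_divergence {φ : Plane → Plane} (hφ : HasCompactSupport φ) :
    HasCompactSupport (divergence φ) := by
  refine (hφ.fderiv ℝ).mono ?_
  intro x hx
  contrapose! hx
  simp only [Function.mem_support, ne_eq, not_not] at hx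
  simp [divergence, hx]

theorem integrable_divergence {φ : Plane → Plane} (hφ : ContDiff ℝ 1 φ)
    (hc : HasCompactSupport φ) : Integrable (divergence φ) :=
  (continuous_divergence hφ).integrable_of_hasCompactSupport (hasCompactSupport_divergence hc)

theorem ofReal_le_perimeter {E : Set Plane} {φ : Plane → Plane} (h1 : ContDiff ℝ 1 φ)
    (h2 : HasCompactSupport φ) (h3 : ∀ x, ‖φ x‖ ≤ 1) :
    ENNReal.ofReal (∫ x in E, divergence φ x) ≤ perimeter E :=
  le_iSup_of_le φ (le_iSup_of_le h1 (le_iSup_of_le h2 (le_iSup_of_le h3 le_rfl)))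

theorem perimeter_le {E : Set Plane} {c : ENNReal}
    (h : ∀ φ : Plane → Plane, ContDiff ℝ 1 φ → HasCompactSupport φ → (∀ x, ‖φ x‖ ≤ 1) →
      ENNReal.ofReal (∫ x in E, divergence φ x) ≤ c) : perimeter E ≤ c :=
  iSup_le fun φ => iSup_le fun h1 => iSup_le fun h2 => iSup_le fun h3 => h φ h1 h2 h3

theorem sum_single_eq (v : Plane) : ∑ i : Fin 2, v i • EuclideanSpace.single i (1 : ℝ) = v := by
  ext j
  fin_cases j <;> simp

/-! ### Minkowski content bounds the perimeter -/

/-- Integration by parts against a Lipschitz function. -/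
theorem integral_mul_divergence {φ : Plane → Plane} (hφ : ContDiff ℝ 1 φ)
    (hc : HasCompactSupport φ) {η : Plane → ℝ} {C : NNReal} (hη : LipschitzWith C η) :
    ∫ x, η x * divergence φ x = - ∫ x, fderiv ℝ η x (φ x) := by
  have hd : Differentiable ℝ φ := hφ.differentiable one_ne_zero
  have hφi : ∀ i, ContDiff ℝ 1 fun x => φ x i := fun i => by fun_prop
  have hci : ∀ i, HasCompactSupport fun x => φ x i := fun i =>
    hc.comp_left (g := fun v : Plane => v i) rfl
  have hline : ∀ i x, lineDeriv ℝ (fun x => φ x i) x (-EuclideanSpace.single i 1)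
      = - fderiv ℝ φ x (EuclideanSpace.single i 1) i := by
    intro i x
    rw [lineDeriv_neg]
    congr 1
    rw [((hφi i).differentiable one_ne_zero x).lineDeriv_eq_fderiv]
    have := (EuclideanSpace.proj (𝕜 := ℝ) i).hasFDerivAt.comp x (hd x).hasFDerivAt
    have h2 := this.fderiv
    simp only [Function.comp_def] at h2
    exact congrArg (fun L => L (EuclideanSpace.single i 1)) h2
  have hparts : ∀ i, ∫ x, lineDeriv ℝ η x (EuclideanSpace.single i 1) * φ x i
      = - ∫ x, η x * fderiv ℝ φ x (EuclideanSpace.single i 1) i := by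
    intro i
    obtain ⟨D, hD⟩ := (hφi i).lipschitzWith_of_hasCompactSupport (hci i) one_ne_zero
    rw [hη.integral_lineDeriv_mul_eq hD (hci i), ← integral_neg]
    refine integral_congr_ae (ae_of_all _ fun x => ?_)
    simp only [hline]
    ring
  have hint1 : ∀ i ∈ Finset.univ, Integrable fun x =>
      η x * fderiv ℝ φ x (EuclideanSpace.single i 1) i := by
    intro i _
    have hcont : Continuous fun x => η x * fderiv ℝ φ x (EuclideanSpace.single i 1) i := by
      have := hφ.continuous_fderiv one_ne_zero
      have h2 := hη.continuous
      fun_prop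
    refine hcont.integrable_of_hasCompactSupport ((hc.fderiv ℝ).mono ?_)
    intro x hx
    contrapose! hx
    simp only [Function.mem_support, ne_eq, not_not] at hx
    simp [hx]
  have hint2 : ∀ i ∈ Finset.univ, Integrable fun x =>
      lineDeriv ℝ η x (EuclideanSpace.single i 1) * φ x i := by
    intro i _
    have hI : Integrable fun x => φ x i :=
      ((hφi i).continuous).integrable_of_hasCompactSupport (hci i)
    refine hI.bdd_mul (c := C * ‖EuclideanSpace.single i (1 : ℝ)‖)
      (measurable_lineDeriv hη.continuous).aestronglyMeasurable ?_
    exact ae_of_all _ fun x => norm_lineDeriv_le_of_lipschitz ℝ hη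
  have hae : ∀ᵐ x, fderiv ℝ η x (φ x)
      = ∑ i : Fin 2, lineDeriv ℝ η x (EuclideanSpace.single i 1) * φ x i := by
    filter_upwards [hη.ae_differentiableAt] with x hx
    conv_lhs => rw [← sum_single_eq (φ x)]
    simp only [map_sum, map_smul, hx.lineDeriv_eq_fderiv, smul_eq_mul]
    exact Finset.sum_congr rfl fun i _ => mul_comm _ _
  rw [integral_congr_ae hae, integral_finsetSum _ hint2]
  simp only [hparts, Finset.sum_neg_distrib, neg_neg]
  rw [← integral_finsetSum _ hint1]
  simp only [divergence, Finset.mul_sum]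

/-- If the area of the `ε`-neighbourhood of a compact set grows at most linearly, with slope `C`,
then `C` bounds the perimeter. -/
theorem perimeter_le_of_volume_cthickening_le {K : Set Plane} (hK : IsCompact K) (hne : K.Nonempty)
    {C C' : ℝ} (hvol : ∀ ε : ℝ, 0 < ε → ε ≤ 1 →
      volume.real (cthickening ε K) ≤ volume.real K + C * ε + C' * ε ^ 2) :
    perimeter K ≤ ENNReal.ofReal C := by
  refine perimeter_le fun φ h1 h2 h3 => ENNReal.ofReal_le_ofReal ?_
  obtain ⟨M, hM⟩ := (continuous_divergence h1).bounded_above_of_compact_support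
    (hasCompactSupport_divergence h2)
  have hM0 : 0 ≤ M := (norm_nonneg _).trans (hM 0)
  have key : ∀ ε : ℝ, 0 < ε → ε ≤ 1 →
      ∫ x in K, divergence φ x ≤ (1 / ε + M) * (C * ε + C' * ε ^ 2) := by
    intro ε hε hε1
    set A := cthickening ε K \ K with hA
    have hAm : MeasurableSet A := isClosed_cthickening.measurableSet.diff hK.measurableSet
    have hAfin : volume A ≠ ⊤ :=
      ((measure_mono Set.sdiff_subset).trans_lt hK.cthickening.measure_lt_top).ne
    have hAvol : volume.real A ≤ C * ε + C' * ε ^ 2 := by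
      rw [hA, measureReal_sdiff (self_subset_cthickening K) hK.measurableSet
        hK.cthickening.measure_lt_top.ne]
      linarith [hvol ε hε hε1]
    set η : Plane → ℝ := fun x => max 0 (1 - infDist x K / ε) with hη
    have hη0 : ∀ x, 0 ≤ η x := fun x => le_max_left _ _
    have hη1 : ∀ x, η x ≤ 1 := fun x => max_le zero_le_one (by
      have := div_nonneg (infDist_nonneg (x := x) (s := K)) hε.le; linarith)
    have hηK : ∀ x ∈ K, η x = 1 := fun x hx => by simp [hη, infDist_zero_of_mem hx]
    have hηout : ∀ x, x ∉ cthickening ε K → η x = 0 := fun x hx => by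
      have : ε < infDist x K := by
        by_contra! hle
        obtain ⟨y, hy, hxy⟩ := hK.exists_infDist_eq_dist hne x
        exact hx (mem_cthickening_of_dist_le x y ε K hy (hxy ▸ hle))
      exact max_eq_left (by rw [sub_nonpos, le_div_iff₀ hε]; linarith)
    have hηL : LipschitzWith (Real.toNNReal (1 / ε)) η := by
      refine LipschitzWith.of_dist_le_mul fun x y => ?_
      rw [Real.coe_toNNReal _ (by positivity), Real.dist_eq]
      rw [hη]
      simp only [max_comm (0 : ℝ)]
      refine (abs_max_sub_max_le_abs _ _ _).trans ?_
      have := (lipschitz_infDist_pt K).dist_le_mul y x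
      rw [Real.dist_eq, NNReal.coe_one, one_mul, dist_comm] at this
      have h : 1 - infDist x K / ε - (1 - infDist y K / ε)
        = (1 / ε) * (infDist y K - infDist x K) := by ring
      rw [h, abs_mul, abs_of_pos (by positivity : 0 < 1 / ε)]
      gcongr
    have hgrad : ∀ x, fderiv ℝ η x (φ x) ≠ 0 → x ∈ A := by
      intro x hx
      by_contra hxA
      apply hx
      by_cases hxK : x ∈ K
      · have : IsLocalMax η x := Eventually.of_forall fun y => by rw [hηK x hxK]; exact hη1 y
        simp [this.fderiv_eq_zero]
      · have hxo : x ∉ cthickening ε K := fun h => hxA ⟨h, hxK⟩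
        have : IsLocalMin η x := Eventually.of_forall fun y => by rw [hηout x hxo]; exact hη0 y
        simp [this.fderiv_eq_zero]
    have hgradle : ∀ x, |fderiv ℝ η x (φ x)| ≤ 1 / ε := by
      intro x
      have := (fderiv ℝ η x).le_opNorm (φ x)
      have h4 := norm_fderiv_le_of_lipschitz ℝ hηL (x₀ := x)
      rw [Real.coe_toNNReal _ (by positivity)] at h4
      calc |fderiv ℝ η x (φ x)| ≤ ‖fderiv ℝ η x‖ * ‖φ x‖ := this
        _ ≤ (1 / ε) * 1 := by gcongr; exact h3 x
        _ = 1 / ε := mul_one _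
    have hb1 : |∫ x, fderiv ℝ η x (φ x)| ≤ (1 / ε) * volume.real A := by
      rw [← setIntegral_eq_integral_of_forall_compl_eq_zero (s := A)
        (fun x hx => by by_contra h; exact hx (hgrad x h))]
      rw [← Real.norm_eq_abs]
      exact norm_setIntegral_le_of_norm_le_const hAfin.lt_top fun x _ => hgradle x
    have hb2 : |∫ x in A, η x * divergence φ x| ≤ M * volume.real A := by
      rw [← Real.norm_eq_abs]
      refine norm_setIntegral_le_of_norm_le_const hAfin.lt_top fun x _ => ?_
      rw [norm_mul, Real.norm_of_nonneg (hη0 x)]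
      calc η x * ‖divergence φ x‖ ≤ 1 * M := by gcongr; exacts [hη1 x, hM x]
        _ = M := one_mul _
    have hint : Integrable fun x => η x * divergence φ x :=
      (integrable_divergence h1 h2).bdd_mul (c := 1) hηL.continuous.aestronglyMeasurable
        (ae_of_all _ fun x => by rw [Real.norm_of_nonneg (hη0 x)]; exact hη1 x)
    have hsplit : ∫ x, η x * divergence φ x
        = (∫ x in K, divergence φ x) + ∫ x in A, η x * divergence φ x := by
      rw [← setIntegral_eq_integral_of_forall_compl_eq_zero (s := cthickening ε K)
        (fun x hx => by simp [hηout x hx])]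
      rw [← Set.union_sdiff_cancel (self_subset_cthickening (δ := ε) K),
        setIntegral_union Set.disjoint_sdiff_right hAm hint.integrableOn hint.integrableOn]
      congr 1
      exact setIntegral_congr_fun hK.measurableSet fun x hx => by simp [hηK x hx]
    have := integral_mul_divergence h1 h2 hηL
    have e1 := (abs_le.1 hb1).1
    have e2 := (abs_le.1 hb2).1
    calc ∫ x in K, divergence φ x ≤ (1 / ε + M) * volume.real A := by linarith
      _ ≤ _ := by gcongr
  have hlim : Tendsto (fun ε : ℝ => (1 + M * ε) * (C + C' * ε)) (𝓝[>] 0)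
      (𝓝 ((1 + M * 0) * (C + C' * 0))) :=
    (Continuous.tendsto (by fun_prop) 0).mono_left nhdsWithin_le_nhds
  have := ge_of_tendsto hlim (b := ∫ x in K, divergence φ x) ?_
  · simpa using this
  · filter_upwards [Ioc_mem_nhdsGT (zero_lt_one' ℝ)] with ε hε
    refine (key ε hε.1 hε.2).trans_eq ?_
    have := hε.1.ne'
    field_simp

theorem volume_real_closedBall (x : Plane) {r : ℝ} (hr : 0 ≤ r) :
    volume.real (closedBall x r) = Real.pi * r ^ 2 := by
  rw [Measure.real, EuclideanSpace.volume_closedBall_fin_two, ENNReal.toReal_mul,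
    ENNReal.toReal_pow, ENNReal.toReal_ofReal hr, ENNReal.toReal_ofReal Real.pi_nonneg, mul_comm]

theorem perimeter_closedBall_le : perimeter (closedBall 0 1) ≤ ENNReal.ofReal (2 * Real.pi) := by
  refine perimeter_le_of_volume_cthickening_le (C' := Real.pi) (isCompact_closedBall _ _)
    ⟨0, by simp⟩ fun ε h0 h1 => ?_
  rw [cthickening_closedBall h0.le zero_le_one, volume_real_closedBall _ (by positivity),
    volume_real_closedBall _ zero_le_one]
  exact le_of_eq (by ring)

/-! ### Orthonormal coordinates -/

/-- Coordinates of the plane with respect to an orthonormal basis. -/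
noncomputable def coord (b : OrthonormalBasis (Fin 2) ℝ Plane) : ℝ × ℝ ≃ᵐ Plane :=
  MeasurableEquiv.finTwoArrow.symm.trans ((MeasurableEquiv.toLp 2 _).trans b.measurableEquiv.symm)

theorem measurePreserving_coord (b : OrthonormalBasis (Fin 2) ℝ Plane) :
    MeasurePreserving (coord b) :=
  ((volume_preserving_finTwoArrow ℝ).symm _).trans
    ((PiLp.volume_preserving_toLp (Fin 2)).trans b.measurePreserving_measurableEquiv.symm)

theorem coord_apply (b : OrthonormalBasis (Fin 2) ℝ Plane) (p : ℝ × ℝ) :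
    coord b p = p.1 • b 0 + p.2 • b 1 := by
  have : coord b p = b.repr.symm (WithLp.toLp 2 ![p.1, p.2]) := rfl
  rw [this, ← b.sum_repr_symm]
  simp [Fin.sum_univ_two]

@[simp] theorem inner_basis_zero_one (b : OrthonormalBasis (Fin 2) ℝ Plane) :
    inner ℝ (b 0) (b 1) = 0 := b.orthonormal.2 (by decide)

@[simp] theorem inner_basis_one_zero (b : OrthonormalBasis (Fin 2) ℝ Plane) :
    inner ℝ (b 1) (b 0) = 0 := b.orthonormal.2 (by decide)

@[simp] theorem inner_basis_self (b : OrthonormalBasis (Fin 2) ℝ Plane) (i : Fin 2) :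
    inner ℝ (b i) (b i) = 1 := by simp [b.orthonormal.1 i]

theorem inner_coord_zero (b : OrthonormalBasis (Fin 2) ℝ Plane) (p : ℝ × ℝ) :
    inner ℝ (coord b p) (b 0) = p.1 := by
  simp only [coord_apply, inner_add_left, real_inner_smul_left, inner_basis_self,
    inner_basis_one_zero, mul_one, mul_zero, add_zero]

theorem inner_coord_one (b : OrthonormalBasis (Fin 2) ℝ Plane) (p : ℝ × ℝ) :
    inner ℝ (coord b p) (b 1) = p.2 := by
  simp only [coord_apply, inner_add_left, real_inner_smul_left, inner_basis_self,
    inner_basis_zero_one, mul_one, mul_zero, zero_add]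

theorem exists_basis_zero_eq {e : Plane} (he : ‖e‖ = 1) :
    ∃ b : OrthonormalBasis (Fin 2) ℝ Plane, b 0 = e := by
  obtain ⟨b, hb⟩ := Orthonormal.exists_orthonormalBasis_extension_of_card_eq (𝕜 := ℝ) (E := Plane)
    (ι := Fin 2) (by simp) (v := fun _ => e) (s := {0}) ⟨fun i => by simpa using he, fun i j hij =>
      absurd (Subsingleton.elim i j) hij⟩
  exact ⟨b, hb 0 rfl⟩

/-- In an orthonormal frame, the divergence is the sum of the frame derivatives of the
components. -/
theorem divergence_eq_of_frame {W : Plane → Plane} {A B : Plane → ℝ} {A' B' : Plane →L[ℝ] ℝ}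
    {e f x : Plane} (hA : HasFDerivAt A A' x) (hB : HasFDerivAt B B' x)
    (hW : W =ᶠ[𝓝 x] fun y => A y • e + B y • f) : divergence W x = A' e + B' f := by
  have h := ((hA.smul_const e).add (hB.smul_const f)).congr_of_eventuallyEq hW
  have key : ∀ (L : Plane →L[ℝ] ℝ) (v : Plane),
      L v = ∑ i : Fin 2, L (EuclideanSpace.single i 1) * v i := by
    intro L v
    conv_lhs => rw [← sum_single_eq v]
    simp only [map_sum, map_smul, smul_eq_mul]
    exact Finset.sum_congr rfl fun i _ => mul_comm _ _
  rw [divergence, h.fderiv, key A', key B', ← Finset.sum_add_distrib]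
  simp

/-! ### The calibration -/

/-- A smooth step from `-1` to `1`, constant outside `[-1, 1]`. -/
noncomputable def softSign (r : ℝ) : ℝ := 2 * Real.smoothTransition ((r + 1) / 2) - 1

theorem contDiff_softSign : ContDiff ℝ 1 softSign := by
  have := Real.smoothTransition.contDiff (n := 1)
  unfold softSign
  fun_prop

theorem monotone_softSign : Monotone softSign := fun x y h => by
  have := Real.smoothTransition.monotone (by linarith : (x + 1) / 2 ≤ (y + 1) / 2)
  unfold softSign
  linarith

theorem softSign_one : softSign 1 = 1 := by norm_num [softSign]

theorem softSign_neg_one : softSign (-1) = -1 := by norm_num [softSign]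

theorem softSign_sq_le_one (r : ℝ) : softSign r ^ 2 ≤ 1 := by
  have h0 := Real.smoothTransition.nonneg ((r + 1) / 2)
  have h1 := Real.smoothTransition.le_one ((r + 1) / 2)
  rw [sq_le_one_iff_abs_le_one, abs_le]
  unfold softSign
  constructor <;> linarith

/-- A cutoff equal to one near each point of a compact set, supported in a given neighbourhood. -/
theorem exists_cutoff {E U : Set Plane} (hE : IsCompact E) (hU : IsOpen U) (hEU : E ⊆ U) :
    ∃ χ : Plane → ℝ, ContDiff ℝ 1 χ ∧ HasCompactSupport χ ∧ tsupport χ ⊆ U ∧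
      (∀ x ∈ E, χ =ᶠ[𝓝 x] fun _ => 1) ∧ ∀ x, 0 ≤ χ x ∧ χ x ≤ 1 := by
  obtain ⟨K, hK, hEK, hKU⟩ := exists_compact_between hE hU hEU
  obtain ⟨f, h1, h0, hf⟩ := exists_contMDiffMap_one_nhds_of_subset_interior
    (I := modelWithCornersSelf ℝ Plane) (n := 1) hE.isClosed hEK
  have hsub : tsupport f ⊆ K :=
    closure_minimal (fun x hx => by by_contra h; exact hx (h0 x h)) hK.isClosed
  exact ⟨f, f.contMDiff.contDiff, hK.of_isClosed_subset (isClosed_tsupport f) hsub,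
    hsub.trans hKU, fun x hx => (eventually_nhdsSet_iff_forall.1 h1 x hx), fun x => hf x⟩

/-- Fubini over a strip of half-width `δ` around the graph of `m`. -/
theorem setIntegral_strip (b : OrthonormalBasis (Fin 2) ℝ Plane) {g : Plane → ℝ}
    (hg : Continuous g) {m : ℝ → ℝ} (hm : Continuous m) {s₁ s₂ δ : ℝ} (hs : s₁ ≤ s₂)
    (hδ : 0 ≤ δ) :
    ∫ x in {x : Plane | inner ℝ x (b 0) ∈ Set.Icc s₁ s₂ ∧
        |inner ℝ x (b 1) - m (inner ℝ x (b 0))| ≤ δ}, g x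
      = ∫ s in s₁..s₂, ∫ t in (m s - δ)..(m s + δ), g (s • b 0 + t • b 1) := by
  set Q := {x : Plane | inner ℝ x (b 0) ∈ Set.Icc s₁ s₂ ∧
    |inner ℝ x (b 1) - m (inner ℝ x (b 0))| ≤ δ} with hQ
  have hpre : coord b ⁻¹' Q = {p : ℝ × ℝ | p.1 ∈ Set.Icc s₁ s₂ ∧ |p.2 - m p.1| ≤ δ} := by
    ext p
    simp only [hQ, Set.mem_preimage, Set.mem_ofPred_eq, inner_coord_zero, inner_coord_one]
  set S := {p : ℝ × ℝ | p.1 ∈ Set.Icc s₁ s₂ ∧ |p.2 - m p.1| ≤ δ} with hS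
  have hSc : IsClosed S := by
    refine (isClosed_Icc.preimage continuous_fst).inter ?_
    exact isClosed_le (f := fun p : ℝ × ℝ => |p.2 - m p.1|) (by fun_prop) continuous_const
  have hSk : IsCompact S := by
    obtain ⟨M, hM⟩ := isCompact_Icc.exists_bound_of_continuousOn
      (hm.continuousOn (s := Set.Icc s₁ s₂))
    refine ((isCompact_Icc (a := s₁) (b := s₂)).prod
      (isCompact_Icc (a := -(M + δ)) (b := M + δ))).of_isClosed_subset hSc fun p hp => ⟨hp.1, ?_⟩
    have h1 := abs_le.1 hp.2
    have h2 := abs_le.1 (hM _ hp.1)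
    constructor <;> linarith [h1.1, h1.2, h2.1, h2.2]
  rw [← (measurePreserving_coord b).setIntegral_preimage_emb (coord b).measurableEmbedding, hpre]
  have hgc : Continuous fun p : ℝ × ℝ => g (coord b p) := by
    simp only [coord_apply]
    fun_prop
  have hint : IntegrableOn (fun p : ℝ × ℝ => g (coord b p)) S :=
    hgc.continuousOn.integrableOn_compact hSk
  rw [← integral_indicator hSc.measurableSet, Measure.volume_eq_prod, integral_prod]
  · rw [intervalIntegral.integral_of_le hs, ← integral_Icc_eq_integral_Ioc,
      ← integral_indicator measurableSet_Icc]
    refine integral_congr_ae (ae_of_all _ fun s => ?_)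
    dsimp only
    by_cases h : s ∈ Set.Icc s₁ s₂
    · rw [Set.indicator_of_mem h, intervalIntegral.integral_of_le (by linarith),
        ← integral_Icc_eq_integral_Ioc, ← integral_indicator measurableSet_Icc]
      refine integral_congr_ae (ae_of_all _ fun t => ?_)
      have hiff : (s, t) ∈ S ↔ t ∈ Set.Icc (m s - δ) (m s + δ) := by
        constructor
        · rintro ⟨-, h1⟩
          have := abs_le.1 h1
          constructor <;> linarith [this.1, this.2]
        · rintro ⟨h1, h2⟩
          exact ⟨h, abs_le.2 ⟨by linarith, by linarith⟩⟩
      by_cases h' : t ∈ Set.Icc (m s - δ) (m s + δ)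
      · simp only [Set.indicator_of_mem h', Set.indicator_of_mem (hiff.2 h'), coord_apply]
      · simp only [Set.indicator_of_notMem h', Set.indicator_of_notMem (mt hiff.1 h')]
    · rw [Set.indicator_of_notMem h]
      refine integral_eq_zero_of_ae (ae_of_all _ fun t => ?_)
      exact Set.indicator_of_notMem (fun h' => h h'.1) _
  · rw [← Measure.volume_eq_prod]
    exact hint.integrable_indicator hSc.measurableSet

/-- A strip around a straight segment between two interior points stays inside a convex set; it
carries the jump of the calibrating field. -/
theorem exists_strip_subset (b : OrthonormalBasis (Fin 2) ℝ Plane) {E : Set Plane}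
    (hconv : Convex ℝ E) {p q : Plane} (hp : p ∈ interior E) (hq : q ∈ interior E)
    (hpq : inner ℝ p (b 0) < inner ℝ q (b 0)) :
    ∃ m : ℝ → ℝ, ContDiff ℝ 1 m ∧ ∃ δ : ℝ, 0 < δ ∧
      {x : Plane | inner ℝ x (b 0) ∈ Set.Icc (inner ℝ p (b 0)) (inner ℝ q (b 0)) ∧
        |inner ℝ x (b 1) - m (inner ℝ x (b 0))| ≤ δ} ⊆ E := by
  have hseg : segment ℝ p q ⊆ interior E := hconv.interior.segment_subset hp hq
  have hcpt : IsCompact (segment ℝ p q) := by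
    rw [segment_eq_image_lineMap]
    exact isCompact_Icc.image (by fun_prop)
  obtain ⟨δ, hδ, hsub⟩ := hcpt.exists_cthickening_subset_open isOpen_interior hseg
  set sp := inner ℝ p (b 0)
  set sq := inner ℝ q (b 0)
  set tp := inner ℝ p (b 1)
  set tq := inner ℝ q (b 1)
  refine ⟨fun s => tp + (s - sp) / (sq - sp) * (tq - tp), by fun_prop, δ, hδ, fun x hx => ?_⟩
  obtain ⟨hx1, hx2⟩ := hx
  refine interior_subset (hsub ?_)
  have hpos : 0 < sq - sp := sub_pos.2 hpq
  set θ := (inner ℝ x (b 0) - sp) / (sq - sp) with hθ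
  have hθ0 : 0 ≤ θ := div_nonneg (by linarith [hx1.1]) hpos.le
  have hθ1 : θ ≤ 1 := (div_le_one hpos).2 (by linarith [hx1.2])
  have hθs : θ * (sq - sp) = inner ℝ x (b 0) - sp := div_mul_cancel₀ _ hpos.ne'
  -- the point of the segment with the same first coordinate as `x`
  set y := (1 - θ) • p + θ • q with hy
  have hyseg : y ∈ segment ℝ p q := ⟨1 - θ, θ, by linarith, hθ0, by ring, rfl⟩
  refine mem_cthickening_of_dist_le x y δ _ hyseg ?_
  have hdiff : x - y = (inner ℝ x (b 1) - (tp + θ * (tq - tp))) • b 1 := by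
    rw [← b.sum_repr' (x - y), Fin.sum_univ_two]
    have e0 : inner ℝ (b 0) (x - y) = 0 := by
      rw [real_inner_comm, inner_sub_left, hy, inner_add_left, real_inner_smul_left,
        real_inner_smul_left]
      change inner ℝ x (b 0) - ((1 - θ) * sp + θ * sq) = 0
      linarith
    have e1 : inner ℝ (b 1) (x - y) = inner ℝ x (b 1) - (tp + θ * (tq - tp)) := by
      rw [real_inner_comm, inner_sub_left, hy, inner_add_left, real_inner_smul_left,
        real_inner_smul_left]
      change inner ℝ x (b 1) - ((1 - θ) * tp + θ * tq) = _
      ring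
    rw [e0, e1, zero_smul, zero_add]
  rw [dist_eq_norm, hdiff, norm_smul, b.orthonormal.1 1, mul_one]
  exact hx2

/-- Calibration by a unit field built from the first coordinate `s`: the field
`k(s) e ± √(1 - k(s)²) f`, with the sign jumping from `-` to `+` across a line inside `E`. The
absolutely continuous part of its divergence is `k'(s)`, and the jump contributes
`2 √(1 - k(s)²)` per unit of `s`. -/
theorem le_perimeter_of_abs_lt_one (b : OrthonormalBasis (Fin 2) ℝ Plane) {E : Set Plane}
    (hE : IsCompact E) (hconv : Convex ℝ E) {p q : Plane} (hp : p ∈ interior E)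
    (hq : q ∈ interior E) (hpq : inner ℝ p (b 0) < inner ℝ q (b 0)) {k : ℝ → ℝ}
    (hk : ContDiff ℝ 1 k) (hk1 : ∀ x ∈ E, |k (inner ℝ x (b 0))| < 1) :
    ENNReal.ofReal ((∫ x in E, deriv k (inner ℝ x (b 0))) +
      2 * ∫ s in (inner ℝ p (b 0))..(inner ℝ q (b 0)), √(1 - k s ^ 2)) ≤ perimeter E := by
  obtain ⟨m, hm, δ, hδ, hstrip⟩ := exists_strip_subset b hconv hp hq hpq
  set e := b 0 with he
  set f := b 1 with hf
  set A : Plane → ℝ := fun x => k (inner ℝ x e) with hA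
  set u : Plane → ℝ := fun x => (inner ℝ x f - m (inner ℝ x e)) / δ with hu
  set r : Plane → ℝ := fun x => √(1 - k (inner ℝ x e) ^ 2) with hr
  set U : Set Plane := {x | |k (inner ℝ x e)| < 1} with hU
  have hkc := hk.continuous
  have hmc := hm.continuous
  have hUo : IsOpen U := isOpen_lt (by fun_prop) continuous_const
  have hUr : ∀ x ∈ U, 0 < 1 - k (inner ℝ x e) ^ 2 := fun x hx => by
    have hx' : |k (inner ℝ x e)| < 1 := hx
    have := (sq_lt_one_iff_abs_lt_one _).2 hx'
    linarith
  obtain ⟨χ, hχ, hχc, hχU, hχ1, hχ01⟩ := exists_cutoff hE hUo hk1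
  have hse : ContDiff ℝ 1 fun x : Plane => inner ℝ x e := contDiff_id.inner ℝ contDiff_const
  have hsf : ContDiff ℝ 1 fun x : Plane => inner ℝ x f := contDiff_id.inner ℝ contDiff_const
  have hAd : ContDiff ℝ 1 A := hk.comp hse
  have hud : ContDiff ℝ 1 fun x => softSign (u x) :=
    contDiff_softSign.comp ((hsf.sub (hm.comp hse)).div_const δ)
  have hrd : ∀ x ∈ U, ContDiffAt ℝ 1 r x := fun x hx => by
    exact ContDiffAt.sqrt (contDiff_const.sub (hAd.pow 2)).contDiffAt (hUr x hx).ne'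
  set B : Plane → ℝ := fun x => softSign (u x) * r x with hB
  have hBd : ∀ x ∈ U, ContDiffAt ℝ 1 B x := fun x hx => hud.contDiffAt.mul (hrd x hx)
  set W : Plane → Plane := fun x => A x • e + B x • f with hW
  set V : Plane → Plane := fun x => χ x • W x with hV
  have hVd : ContDiff ℝ 1 V := by
    rw [contDiff_iff_contDiffAt]
    intro x
    by_cases hx : x ∈ tsupport χ
    · have h1 := hBd x (hχU hx)
      have h2 := hχ.contDiffAt (x := x)
      have h3 := hAd.contDiffAt (x := x)
      fun_prop
    · have : V =ᶠ[𝓝 x] fun _ => 0 := by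
        filter_upwards [notMem_tsupport_iff_eventuallyEq.1 hx] with y hy
        simp [hV, hy]
      exact contDiffAt_const.congr_of_eventuallyEq this
  have hVc : HasCompactSupport V := hχc.smul_right
  have hWn : ∀ x ∈ U, ‖W x‖ ≤ 1 := by
    intro x hx
    have hsq : ‖W x‖ ^ 2 = A x ^ 2 + B x ^ 2 := by
      rw [← real_inner_self_eq_norm_sq, hW]
      simp only [inner_add_left, inner_add_right, real_inner_smul_left, real_inner_smul_right,
        he, hf, inner_basis_self, inner_basis_zero_one, inner_basis_one_zero]
      ring
    have h1 : r x ^ 2 = 1 - A x ^ 2 := Real.sq_sqrt (hUr x hx).le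
    have h2 := softSign_sq_le_one (u x)
    have h3 : B x ^ 2 ≤ r x ^ 2 := by
      rw [hB]
      simp only [mul_pow]
      nlinarith [sq_nonneg (r x)]
    rw [← sq_le_one_iff₀ (norm_nonneg _), hsq]
    linarith
  have hVn : ∀ x, ‖V x‖ ≤ 1 := by
    intro x
    by_cases hx : x ∈ tsupport χ
    · rw [hV]
      simp only [norm_smul, Real.norm_of_nonneg (hχ01 x).1]
      exact mul_le_one₀ (hχ01 x).2 (norm_nonneg _) (hWn x (hχU hx))
    · simp [hV, image_eq_zero_of_notMem_tsupport hx]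
  -- the density of the jump part
  set β : Plane → ℝ := fun x => deriv softSign (u x) / δ * r x with hβ
  have hβc : Continuous β := by
    have := contDiff_softSign.continuous_deriv_one
    fun_prop
  have hβ0 : ∀ x, 0 ≤ β x := fun x =>
    mul_nonneg (div_nonneg (monotone_softSign.deriv_nonneg) hδ.le) (Real.sqrt_nonneg _)
  have hdiv : ∀ x ∈ E, divergence V x = deriv k (inner ℝ x e) + β x := by
    intro x hx
    have hxU : x ∈ U := hk1 x hx
    have hA' := (hAd.differentiable one_ne_zero x).hasFDerivAt
    have hB' := ((hBd x hxU).differentiableAt one_ne_zero).hasFDerivAt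
    have heq : V =ᶠ[𝓝 x] fun y => A y • e + B y • f := by
      filter_upwards [hχ1 x hx] with y hy
      simp [hV, hW, hy]
    rw [divergence_eq_of_frame hA' hB' heq]
    congr 1
    · refine (hA'.hasLineDerivAt e).unique ?_
      have hin : ∀ t : ℝ, A (x + t • e) = k (inner ℝ x e + t) := fun t => by
        rw [hA]
        simp only [inner_add_left, real_inner_smul_left, he, inner_basis_self, mul_one]
      have := ((hk.differentiable one_ne_zero (inner ℝ x e + 0)).hasDerivAt).comp_const_add
        (inner ℝ x e) 0
      rw [add_zero] at this
      exact this.congr_of_eventuallyEq (Eventually.of_forall hin)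
    · refine (hB'.hasLineDerivAt f).unique ?_
      have hin : ∀ t : ℝ, B (x + t • f) = softSign (u x + t / δ) * r x := fun t => by
        rw [hB, hr, hu]
        simp only [inner_add_left, real_inner_smul_left, he, hf, inner_basis_self,
          inner_basis_one_zero, mul_one, mul_zero, add_zero]
        congr 2
        ring
      have h1 : HasDerivAt (fun t : ℝ => u x + t / δ) (1 / δ) 0 :=
        ((hasDerivAt_id (0 : ℝ)).div_const δ).const_add _
      have h2 : HasDerivAt softSign (deriv softSign (u x)) (u x + 0 / δ) := by
        rw [zero_div, add_zero]
        exact (contDiff_softSign.differentiable one_ne_zero _).hasDerivAt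
      have h3 := (h2.comp (0 : ℝ) h1).mul_const (r x)
      refine (h3.congr_of_eventuallyEq (Eventually.of_forall hin)).congr_deriv ?_
      rw [hβ]
      ring
  have hk' := hk.continuous_deriv_one
  have hint1 : IntegrableOn (fun x : Plane => deriv k (inner ℝ x e)) E :=
    (Continuous.continuousOn (by fun_prop)).integrableOn_compact hE
  have hint2 : IntegrableOn β E := hβc.continuousOn.integrableOn_compact hE
  have hjump : 2 * ∫ s in (inner ℝ p e)..(inner ℝ q e), √(1 - k s ^ 2) ≤ ∫ x in E, β x := by
    refine le_trans (le_of_eq ?_) (setIntegral_mono_set hint2 (ae_of_all _ hβ0)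
      (LE.le.eventuallyLE hstrip))
    rw [setIntegral_strip b hβc hmc hpq.le hδ.le, ← intervalIntegral.integral_const_mul]
    refine intervalIntegral.integral_congr fun s _ => ?_
    have hin : ∀ t : ℝ, β (s • b 0 + t • b 1)
        = deriv softSign ((t - m s) / δ) * (1 / δ) * √(1 - k s ^ 2) := fun t => by
      rw [hβ, hr, hu]
      simp only [inner_add_left, real_inner_smul_left, he, hf, inner_basis_self,
        inner_basis_zero_one, inner_basis_one_zero, mul_one, mul_zero, add_zero, zero_add]
      ring
    simp only [hin]
    rw [intervalIntegral.integral_mul_const,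
      intervalIntegral.integral_eq_sub_of_hasDerivAt (f := fun t => softSign ((t - m s) / δ))]
    · have e1 : (m s + δ - m s) / δ = 1 := by field_simp; ring
      have e2 : (m s - δ - m s) / δ = -1 := by field_simp; ring
      rw [e1, e2, softSign_one, softSign_neg_one]
      ring
    · intro t _
      exact (contDiff_softSign.differentiable one_ne_zero _).hasDerivAt.comp t
        (((hasDerivAt_id t).sub_const _).div_const δ)
    · have := contDiff_softSign.continuous_deriv_one
      exact Continuous.intervalIntegrable (by fun_prop) _ _
  refine le_trans (ENNReal.ofReal_le_ofReal ?_) (ofReal_le_perimeter hVd hVc hVn)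
  rw [setIntegral_congr_fun hE.measurableSet hdiv, integral_add hint1 hint2]
  linarith

/-- The calibration inequality over the whole projection `[α, β]` of `E`. -/
theorem le_perimeter_of_abs_le_one (b : OrthonormalBasis (Fin 2) ℝ Plane) {E : Set Plane}
    (hE : IsCompact E) (hconv : Convex ℝ E) (hne : (interior E).Nonempty) {p q : Plane}
    (hp : p ∈ E) (hq : q ∈ E) (hpq : inner ℝ p (b 0) < inner ℝ q (b 0)) {k : ℝ → ℝ}
    (hk : ContDiff ℝ 1 k) (hk1 : ∀ x ∈ E, |k (inner ℝ x (b 0))| ≤ 1) :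
    ENNReal.ofReal ((∫ x in E, deriv k (inner ℝ x (b 0))) +
      2 * ∫ s in (inner ℝ p (b 0))..(inner ℝ q (b 0)), √(1 - k s ^ 2)) ≤ perimeter E := by
  obtain ⟨c, hc⟩ := hne
  set g : ℝ → ℝ := fun s => √(1 - k s ^ 2) with hg
  have hkc := hk.continuous
  have hgc : Continuous g := by fun_prop
  have hgi : ∀ x y, IntervalIntegrable g volume x y := fun x y => hgc.intervalIntegrable x y
  -- Points of the interior close to `p`, `q`, and the shrunken profile `(1 - t) k`.
  set P : ℝ → ℝ := fun t => (1 - t) * inner ℝ p (b 0) + t * inner ℝ c (b 0) with hP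
  set Q : ℝ → ℝ := fun t => (1 - t) * inner ℝ q (b 0) + t * inner ℝ c (b 0) with hQ
  have hlim : Tendsto (fun t : ℝ => ENNReal.ofReal ((1 - t) * (∫ x in E, deriv k (inner ℝ x (b 0)))
      + 2 * ∫ s in (P t)..(Q t), g s)) (𝓝[>] 0)
      (𝓝 (ENNReal.ofReal ((∫ x in E, deriv k (inner ℝ x (b 0))) +
        2 * ∫ s in (inner ℝ p (b 0))..(inner ℝ q (b 0)), g s))) := by
    refine ENNReal.tendsto_ofReal ?_
    have hF : Continuous fun x => ∫ s in (0 : ℝ)..x, g s :=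
      intervalIntegral.continuous_primitive hgi 0
    have hI : ∀ x y, ∫ s in x..y, g s = (∫ s in (0 : ℝ)..y, g s) - ∫ s in (0 : ℝ)..x, g s :=
      fun x y => (intervalIntegral.integral_interval_sub_left (hgi _ _) (hgi _ _)).symm
    have hcont : Continuous fun t : ℝ => (1 - t) * (∫ x in E, deriv k (inner ℝ x (b 0)))
        + 2 * ∫ s in (P t)..(Q t), g s := by
      have h1 : Continuous fun t => ∫ s in (0 : ℝ)..(P t), g s := hF.comp (by fun_prop)
      have h2 : Continuous fun t => ∫ s in (0 : ℝ)..(Q t), g s := hF.comp (by fun_prop)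
      have h3 : Continuous fun t => ∫ s in (P t)..(Q t), g s := by
        rw [show (fun t => ∫ s in (P t)..(Q t), g s) = _ from funext fun t => hI (P t) (Q t)]
        exact h2.sub h1
      fun_prop
    have := hcont.tendsto 0
    simp only [hP, hQ, sub_zero, one_mul, zero_mul, add_zero] at this
    exact this.mono_left nhdsWithin_le_nhds
  refine le_of_tendsto hlim ?_
  filter_upwards [Ioo_mem_nhdsGT (zero_lt_one' ℝ)] with t ht
  have ht1 : 0 < 1 - t := by linarith [ht.2]
  have hmem : ∀ x ∈ E, (1 - t) • x + t • c ∈ interior E := fun x hx =>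
    hconv.combo_self_interior_mem_interior hx hc ht1.le ht.1 (by ring)
  have hin : ∀ x : Plane, inner ℝ ((1 - t) • x + t • c) (b 0)
      = (1 - t) * inner ℝ x (b 0) + t * inner ℝ c (b 0) := fun x => by
    rw [inner_add_left, real_inner_smul_left, real_inner_smul_left]
  have hlt : P t < Q t := by
    simp only [hP, hQ]
    gcongr
  have hstrict := le_perimeter_of_abs_lt_one b hE hconv (hmem p hp) (hmem q hq)
    (by rw [hin, hin]; exact hlt) (k := fun s => (1 - t) * k s) (by fun_prop) (fun x hx => by
      rw [abs_mul, abs_of_pos ht1]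
      calc (1 - t) * |k (inner ℝ x (b 0))| ≤ (1 - t) * 1 := by gcongr; exact hk1 x hx
        _ < 1 := by linarith [ht.1])
  refine le_trans (ENNReal.ofReal_le_ofReal ?_) hstrict
  rw [hin, hin]
  have hder : ∀ s, deriv (fun s => (1 - t) * k s) s = (1 - t) * deriv k s := fun s =>
    deriv_const_mul _ (hk.differentiable one_ne_zero s)
  simp only [hder]
  rw [integral_const_mul]
  gcongr
  refine intervalIntegral.integral_mono_on hlt.le (hgi _ _)
    (Continuous.intervalIntegrable (by fun_prop) _ _) fun s _ => ?_
  refine Real.sqrt_le_sqrt ?_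
  have : ((1 - t) * k s) ^ 2 ≤ k s ^ 2 := by
    rw [mul_pow]
    refine mul_le_of_le_one_left (sq_nonneg _) ?_
    rw [sq_le_one_iff₀ ht1.le]
    linarith [ht.1]
  linarith

/-! ### Stability of the isoperimetric inequality for convex sets -/

theorem one_sub_le_sqrt {v : ℝ} (h1 : -1 ≤ v) (h2 : v ≤ 1) :
    1 - v / 2 - v ^ 2 / 2 ≤ √(1 - v) := by
  refine Real.le_sqrt_of_sq_le ?_
  nlinarith [mul_nonneg (mul_nonneg (sq_nonneg v) (by linarith : 0 ≤ 3 + v))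
    (by linarith : 0 ≤ 1 - v)]

theorem integral_id_mul_sqrt_one_sub_sq : ∫ s in (-1 : ℝ)..1, s * √(1 - s ^ 2) = 0 := by
  have h := intervalIntegral.integral_comp_neg (a := -1) (b := 1) fun s : ℝ => s * √(1 - s ^ 2)
  simp only [neg_sq, neg_mul, neg_neg, intervalIntegral.integral_neg] at h
  linarith

/-- Lower bound for the length of the profile `s + ε (1 - s²)`: the first order term in `ε`
vanishes by oddness. -/
theorem le_integral_sqrt_perturbed {ε : ℝ} (hε : |ε| ≤ 1 / 3) :
    Real.pi / 2 * (1 - 5 * ε ^ 2) ≤ ∫ s in (-1 : ℝ)..1, √(1 - (s + ε * (1 - s ^ 2)) ^ 2) := by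
  have hεb := abs_le.1 hε
  have h0 : ∫ s in (-1 : ℝ)..1, ((1 - 5 * ε ^ 2) * √(1 - s ^ 2) - ε * (s * √(1 - s ^ 2)))
      = Real.pi / 2 * (1 - 5 * ε ^ 2) := by
    rw [intervalIntegral.integral_sub (Continuous.intervalIntegrable (by fun_prop) _ _)
      (Continuous.intervalIntegrable (by fun_prop) _ _), intervalIntegral.integral_const_mul,
      intervalIntegral.integral_const_mul, integral_id_mul_sqrt_one_sub_sq,
      integral_sqrt_one_sub_sq]
    ring
  rw [← h0]
  refine intervalIntegral.integral_mono_on (by norm_num)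
    (Continuous.intervalIntegrable (by fun_prop) _ _)
    (Continuous.intervalIntegrable (by fun_prop) _ _) fun s hs => ?_
  have hs2 : 0 ≤ 1 - s ^ 2 := by nlinarith [hs.1, hs.2]
  have hε2 : ε ^ 2 ≤ 1 / 9 := by nlinarith
  set v := 2 * ε * s + ε ^ 2 * (1 - s ^ 2) with hv
  have hfac : 1 - (s + ε * (1 - s ^ 2)) ^ 2 = (1 - s ^ 2) * (1 - v) := by rw [hv]; ring
  have hεs : |ε * s| ≤ |ε| := by
    rw [abs_mul]
    exact mul_le_of_le_one_right (abs_nonneg _) (abs_le.2 hs)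
  have hvle : |v| ≤ 7 / 3 * |ε| := by
    have h1 : |v| ≤ 2 * |ε * s| + |ε ^ 2 * (1 - s ^ 2)| := by
      rw [hv, mul_assoc]
      refine (abs_add_le _ _).trans_eq ?_
      rw [abs_mul (2 : ℝ), abs_of_pos (zero_lt_two' ℝ)]
    have h2 : |ε ^ 2 * (1 - s ^ 2)| ≤ 1 / 3 * |ε| := by
      rw [abs_of_nonneg (by positivity), ← sq_abs]
      nlinarith [sq_nonneg s, abs_nonneg ε, mul_nonneg (abs_nonneg ε) (sub_nonneg.2 hε),
        mul_nonneg (sq_nonneg |ε|) (sq_nonneg s)]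
    linarith
  have hv1 := abs_le.1 (hvle.trans (by linarith : 7 / 3 * |ε| ≤ 1))
  have hvsq : v ^ 2 ≤ 49 / 9 * ε ^ 2 := by
    have := pow_le_pow_left₀ (abs_nonneg v) hvle 2
    rw [sq_abs, mul_pow, sq_abs] at this
    linarith
  rw [hfac, Real.sqrt_mul hs2]
  have h3 := one_sub_le_sqrt hv1.1 hv1.2
  have h4 : 1 - 5 * ε ^ 2 - ε * s ≤ √(1 - v) := by
    refine le_trans ?_ h3
    rw [hv] at hvsq ⊢
    nlinarith [mul_nonneg (sq_nonneg ε) (sq_nonneg s)]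
  calc (1 - 5 * ε ^ 2) * √(1 - s ^ 2) - ε * (s * √(1 - s ^ 2))
      = √(1 - s ^ 2) * (1 - 5 * ε ^ 2 - ε * s) := by ring
    _ ≤ √(1 - s ^ 2) * √(1 - v) := by gcongr

/-- The centre of mass of a set of area `π`. -/
noncomputable def barycenter (E : Set Plane) : Plane := Real.pi⁻¹ • ∫ x in E, x

/-- For every direction `e`, with `[μ - τ, μ + τ]` the projection of `E` and `w` the offset of the
barycentre from the midpoint, a one-parameter family of lower bounds for the perimeter. -/
theorem exists_projection_le_perimeter {E : Set Plane} (hE : IsCompact E) (hconv : Convex ℝ E)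
    (hne : (interior E).Nonempty) (hvol : volume.real E = Real.pi) {e : Plane} (he : ‖e‖ = 1) :
    ∃ μ τ : ℝ, 0 < τ ∧ (∃ p ∈ E, inner ℝ p e = μ - τ) ∧ (∃ q ∈ E, inner ℝ q e = μ + τ) ∧
      (∀ x ∈ E, |inner ℝ x e - μ| ≤ τ) ∧ |inner ℝ (barycenter E) e - μ| ≤ τ ∧
      ∀ ε : ℝ, |ε| ≤ 1 / 3 → ENNReal.ofReal (Real.pi / τ + Real.pi * τ
        - 2 * ε * Real.pi * (inner ℝ (barycenter E) e - μ) / τ ^ 2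
        - 5 * Real.pi * τ * ε ^ 2) ≤ perimeter E := by
  obtain ⟨b, rfl⟩ := exists_basis_zero_eq he
  have hEne : E.Nonempty := hne.mono interior_subset
  have hse : Continuous fun x : Plane => inner ℝ x (b 0) := by fun_prop
  obtain ⟨p, hp, hpmin⟩ := hE.exists_isMinOn hEne hse.continuousOn
  obtain ⟨q, hq, hqmax⟩ := hE.exists_isMaxOn hEne hse.continuousOn
  rw [isMinOn_iff] at hpmin
  rw [isMaxOn_iff] at hqmax
  have hpq : inner ℝ p (b 0) < inner ℝ q (b 0) := by
    obtain ⟨c, hc⟩ := hne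
    have hnhds : Tendsto (fun t : ℝ => c + t • b 0) (𝓝[>] 0) (𝓝 c) := by
      have : Continuous fun t : ℝ => c + t • b 0 := by fun_prop
      have h := this.tendsto 0
      simp only [zero_smul, add_zero] at h
      exact h.mono_left nhdsWithin_le_nhds
    obtain ⟨t, htE, ht⟩ := ((hnhds.eventually (mem_interior_iff_mem_nhds.1 hc)).and
      self_mem_nhdsWithin).exists
    have h1 := hqmax _ htE
    have h2 := hpmin c (interior_subset hc)
    have ht' : (0 : ℝ) < t := ht
    simp only [inner_add_left, real_inner_smul_left, inner_basis_self] at h1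
    linarith
  set μ := (inner ℝ p (b 0) + inner ℝ q (b 0)) / 2 with hμ
  set τ := (inner ℝ q (b 0) - inner ℝ p (b 0)) / 2 with hτ
  have hτ0 : 0 < τ := by rw [hτ]; linarith
  have hpe : inner ℝ p (b 0) = μ - τ := by rw [hμ, hτ]; ring
  have hqe : inner ℝ q (b 0) = μ + τ := by rw [hμ, hτ]; ring
  have hproj : ∀ x ∈ E, |inner ℝ x (b 0) - μ| ≤ τ := fun x hx => by
    rw [abs_le]
    constructor <;> linarith [hpmin x hx, hqmax x hx]
  have hint : IntegrableOn (fun x : Plane => inner ℝ x (b 0)) E :=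
    hse.continuousOn.integrableOn_compact hE
  have hintc : ∀ c : ℝ, IntegrableOn (fun _ : Plane => c) E := fun c =>
    continuousOn_const.integrableOn_compact hE
  have hbar : ∫ x in E, (inner ℝ x (b 0) - μ) = Real.pi * (inner ℝ (barycenter E) (b 0) - μ) := by
    have h1 : ∫ x in E, inner ℝ x (b 0) = inner ℝ (∫ x in E, x) (b 0) := by
      have := integral_inner (𝕜 := ℝ) (μ := volume.restrict E) (f := fun x : Plane => x)
        (continuous_id.continuousOn.integrableOn_compact hE) (b 0)
      rw [real_inner_comm, ← this]
      exact integral_congr_ae (ae_of_all _ fun x => real_inner_comm _ _)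
    rw [integral_sub hint (hintc μ), h1, setIntegral_const, hvol, barycenter,
      real_inner_smul_left, smul_eq_mul]
    have := Real.pi_ne_zero
    field_simp
  refine ⟨μ, τ, hτ0, ⟨p, hp, hpe⟩, ⟨q, hq, hqe⟩, hproj, ?_, fun ε hε => ?_⟩
  · have h1 : |∫ x in E, (inner ℝ x (b 0) - μ)| ≤ τ * volume.real E := by
      rw [← Real.norm_eq_abs]
      exact norm_setIntegral_le_of_norm_le_const hE.measure_lt_top fun x hx => hproj x hx
    rw [hbar, hvol, abs_mul, abs_of_pos Real.pi_pos, mul_comm] at h1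
    exact le_of_mul_le_mul_right h1 Real.pi_pos
  · set k : ℝ → ℝ := fun y => (y - μ) / τ + ε * (1 - ((y - μ) / τ) ^ 2) with hk
    have hεb := abs_le.1 hε
    have hkbd : ∀ x ∈ E, |k (inner ℝ x (b 0))| ≤ 1 := by
      intro x hx
      set s := (inner ℝ x (b 0) - μ) / τ with hs
      have hs1 : |s| ≤ 1 := by
        rw [hs, abs_div, abs_of_pos hτ0]
        exact (div_le_one hτ0).2 (hproj x hx)
      have hsb := abs_le.1 hs1
      rw [abs_le]
      change -1 ≤ s + ε * (1 - s ^ 2) ∧ s + ε * (1 - s ^ 2) ≤ 1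
      have e1 : 0 ≤ 1 + s := by linarith
      have e2 : 0 ≤ 1 - s := by linarith
      constructor
      · nlinarith [mul_nonneg e1 (by nlinarith : 0 ≤ 1 + ε * (1 - s))]
      · nlinarith [mul_nonneg e2 (by nlinarith : 0 ≤ 1 - ε * (1 + s))]
    have hder : ∀ y, deriv k y = 1 / τ - 2 * ε / τ ^ 2 * (y - μ) := by
      intro y
      have h1 : HasDerivAt (fun y : ℝ => (y - μ) / τ) (1 / τ) y :=
        ((hasDerivAt_id y).sub_const μ).div_const τ
      have h2 := h1.add (((h1.pow 2).const_sub 1).const_mul ε)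
      have h3 : HasDerivAt k _ y := h2
      rw [h3.deriv]
      simp only [Nat.cast_ofNat, Nat.add_one_sub_one, pow_one]
      field_simp
      ring
    have hcal := le_perimeter_of_abs_le_one b hE hconv hne hp hq hpq (k := k) (by fun_prop) hkbd
    refine le_trans (ENNReal.ofReal_le_ofReal ?_) hcal
    have hI1 : ∫ x in E, deriv k (inner ℝ x (b 0))
        = Real.pi / τ - 2 * ε / τ ^ 2 * (Real.pi * (inner ℝ (barycenter E) (b 0) - μ)) := by
      have hint' : IntegrableOn (fun x : Plane => inner ℝ x (b 0) - μ) E := hint.sub (hintc μ)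
      simp only [hder]
      rw [integral_sub (hintc _) (hint'.const_mul _), setIntegral_const, hvol,
        integral_const_mul, hbar, smul_eq_mul]
      ring
    have hI2 : ∫ y in (inner ℝ p (b 0))..(inner ℝ q (b 0)), √(1 - k y ^ 2)
        = τ * ∫ s in (-1 : ℝ)..1, √(1 - (s + ε * (1 - s ^ 2)) ^ 2) := by
      have h := intervalIntegral.mul_integral_comp_mul_add (a := -1) (b := 1)
        (f := fun y => √(1 - k y ^ 2)) τ μ
      rw [hpe, hqe]
      have e1 : τ * -1 + μ = μ - τ := by ring
      have e2 : τ * 1 + μ = μ + τ := by ring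
      rw [e1, e2] at h
      rw [← h]
      congr 1
      refine intervalIntegral.integral_congr fun s _ => ?_
      have : (τ * s + μ - μ) / τ = s := by field_simp; ring
      simp only [hk, this]
    rw [hI1, hI2]
    have h5 := mul_le_mul_of_nonneg_left (le_integral_sqrt_perturbed hε) hτ0.le
    have : 2 * ε / τ ^ 2 * (Real.pi * (inner ℝ (barycenter E) (b 0) - μ))
      = 2 * ε * Real.pi * (inner ℝ (barycenter E) (b 0) - μ) / τ ^ 2 := by ring
    rw [this]
    linarith

/-- The isoperimetric inequality for convex sets of area `π`. -/
theorem two_pi_le_perimeter {E : Set Plane} (hE : IsCompact E) (hconv : Convex ℝ E)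
    (hne : (interior E).Nonempty) (hvol : volume.real E = Real.pi) :
    ENNReal.ofReal (2 * Real.pi) ≤ perimeter E := by
  obtain ⟨e, he⟩ := exists_norm_eq Plane zero_le_one
  obtain ⟨μ, τ, hτ, -, -, -, -, h⟩ := exists_projection_le_perimeter hE hconv hne hvol he
  refine le_trans (ENNReal.ofReal_le_ofReal ?_) (h 0 (by norm_num))
  have : Real.pi / τ + Real.pi * τ - 2 * Real.pi = Real.pi * (τ - 1) ^ 2 / τ := by
    field_simp
    ring
  have h2 : 0 ≤ Real.pi * (τ - 1) ^ 2 / τ := by positivity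
  simp only [mul_zero, zero_mul, zero_div, sub_zero, ne_eq, OfNat.ofNat_ne_zero,
    not_false_eq_true, zero_pow]
  linarith

theorem perimeter_unit_closedBall : perimeter (closedBall 0 1) = ENNReal.ofReal (2 * Real.pi) := by
  refine le_antisymm perimeter_closedBall_le (two_pi_le_perimeter (isCompact_closedBall _ _)
    (convex_closedBall _ _) ?_ ?_)
  · exact ⟨0, ball_subset_interior_closedBall (by simp)⟩
  · rw [volume_real_closedBall _ zero_le_one]
    ring

/-- Quantitative control of the support function: if the deficit is at most `d` then the support
function differs from that of the unit disc about the barycentre by at most `25 √d`. -/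
theorem exists_inner_sub_le {E : Set Plane} (hE : IsCompact E) (hconv : Convex ℝ E)
    (hne : (interior E).Nonempty) (hvol : volume.real E = Real.pi) {z' : Plane}
    (hsub : E ⊆ closedBall z' 2) {d : ℝ} (hd : 0 ≤ d)
    (hP : perimeter E ≤ ENNReal.ofReal (2 * Real.pi * (1 + d))) {e : Plane} (he : ‖e‖ = 1) :
    (∀ x ∈ E, inner ℝ x e ≤ inner ℝ (barycenter E) e + 1 + 25 * √d) ∧
      ∃ q ∈ E, inner ℝ (barycenter E) e + 1 - 25 * √d ≤ inner ℝ q e := by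
  obtain ⟨μ, τ, hτ, ⟨p, hp, hpe⟩, ⟨q, hq, hqe⟩, hproj, hw, h⟩ :=
    exists_projection_le_perimeter hE hconv hne hvol he
  have hτ2 : τ ≤ 2 := by
    have h1 : ‖q - p‖ ≤ 4 := by
      rw [← dist_eq_norm]
      linarith [dist_triangle_right q p z', mem_closedBall.1 (hsub hp), mem_closedBall.1 (hsub hq)]
    have h2 := real_inner_le_norm (q - p) e
    rw [he, mul_one, inner_sub_left] at h2
    linarith
  set w := inner ℝ (barycenter E) e - μ with hwdef
  have hpi := Real.pi_pos
  -- The parameter `ε = -w / 100` makes the linear term positive; as `τ ≤ 2`, the factor `1 / 100`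
  -- keeps the quadratic error below it.
  have hmain : 1 / τ + τ + w ^ 2 / (50 * τ ^ 2) - 5 * τ * (w / 100) ^ 2 ≤ 2 * (1 + d) := by
    have h1 := (h (-w / 100) (by
      rw [abs_div, abs_neg, abs_of_pos (by norm_num : (0 : ℝ) < 100)]; linarith)).trans hP
    rw [ENNReal.ofReal_le_ofReal_iff (by positivity)] at h1
    have h2 : Real.pi / τ + Real.pi * τ - 2 * (-w / 100) * Real.pi * w / τ ^ 2
        - 5 * Real.pi * τ * (-w / 100) ^ 2
        = Real.pi * (1 / τ + τ + w ^ 2 / (50 * τ ^ 2) - 5 * τ * (w / 100) ^ 2) := by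
      field_simp
      ring
    rw [h2] at h1
    refine le_of_mul_le_mul_left (h1.trans_eq ?_) hpi
    ring
  have h50 : w ^ 2 / 200 ≤ w ^ 2 / (50 * τ ^ 2) := by
    gcongr
    nlinarith
  have hτsq : (τ - 1) ^ 2 / 2 ≤ 1 / τ + τ - 2 := by
    have : 1 / τ + τ - 2 = (τ - 1) ^ 2 / τ := by field_simp; ring
    rw [this]
    gcongr
  have hw5 : 5 * τ * (w / 100) ^ 2 ≤ w ^ 2 / 1000 := by nlinarith [sq_nonneg w]
  have b1 : |τ - 1| ≤ 2 * √d := by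
    refine abs_le_of_sq_le_sq ?_ (by positivity)
    rw [mul_pow, Real.sq_sqrt hd]
    nlinarith [sq_nonneg w]
  have b2 : |w| ≤ 23 * √d := by
    refine abs_le_of_sq_le_sq ?_ (by positivity)
    rw [mul_pow, Real.sq_sqrt hd]
    nlinarith [sq_nonneg (τ - 1)]
  rw [abs_le] at b1 b2
  refine ⟨fun x hx => ?_, q, hq, ?_⟩
  · have := (abs_le.1 (hproj x hx)).2
    linarith [b1.2, b2.1]
  · linarith [b1.1, b2.2]

/-- A point outside a closed convex set is reached from its nearest point along an outer unit
normal. -/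
theorem exists_unit_normal {E : Set Plane} (hE : IsClosed E) (hconv : Convex ℝ E)
    (hne : E.Nonempty) {y : Plane} (hy : y ∉ E) :
    ∃ p ∈ E, ∃ e : Plane, ‖e‖ = 1 ∧ 0 < ‖y - p‖ ∧ y - p = ‖y - p‖ • e ∧
      ∀ x ∈ E, inner ℝ x e ≤ inner ℝ p e := by
  obtain ⟨p, hp, hpd⟩ := hE.exists_infDist_eq_dist hne y
  have hn : 0 < ‖y - p‖ := norm_pos_iff.2 (sub_ne_zero.2 fun h => hy (h ▸ hp))
  refine ⟨p, hp, ‖y - p‖⁻¹ • (y - p), ?_, hn, ?_, fun x hx => ?_⟩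
  · rw [norm_smul, norm_inv, norm_norm, inv_mul_cancel₀ hn.ne']
  · rw [smul_smul, mul_inv_cancel₀ hn.ne', one_smul]
  · have hobt : inner ℝ (y - p) (x - p) ≤ 0 := by
      refine (norm_eq_iInf_iff_real_inner_le_zero hconv hp).1 ?_ x hx
      rw [← dist_eq_norm, ← hpd, infDist_eq_iInf]
      simp only [dist_eq_norm]
    have : inner ℝ (x - p) (‖y - p‖⁻¹ • (y - p)) ≤ 0 := by
      rw [real_inner_smul_right, real_inner_comm]
      exact mul_nonpos_of_nonneg_of_nonpos (by positivity) hobt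
    rw [inner_sub_left] at this
    linarith

/-- Stability of the isoperimetric inequality in the Hausdorff distance. -/
theorem hausdorffEDist_barycenter_le {E : Set Plane} (hE : IsCompact E) (hconv : Convex ℝ E)
    (hne : (interior E).Nonempty) (hvol : volume.real E = Real.pi) {z' : Plane}
    (hsub : E ⊆ closedBall z' 2) {d : ℝ} (hd : 0 ≤ d)
    (hP : perimeter E ≤ ENNReal.ofReal (2 * Real.pi * (1 + d))) :
    hausdorffEDist E (closedBall (barycenter E) 1) ≤ ENNReal.ofReal (25 * √d) := by
  have hEne : E.Nonempty := hne.mono interior_subset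
  set z := barycenter E
  have hρ : 0 ≤ 25 * √d := by positivity
  refine hausdorffEDist_le_of_mem_edist (fun x hx => ?_) (fun y hy => ?_)
  · by_cases hxz : ‖x - z‖ ≤ 1
    · exact ⟨x, by rwa [mem_closedBall, dist_eq_norm], by simp⟩
    · rw [not_le] at hxz
      have hn : ‖x - z‖ ≠ 0 := by linarith
      set e := ‖x - z‖⁻¹ • (x - z) with he
      have hen : ‖e‖ = 1 := by rw [he, norm_smul, norm_inv, norm_norm, inv_mul_cancel₀ hn]
      refine ⟨z + e, by simp [hen], ?_⟩
      have h1 := (exists_inner_sub_le hE hconv hne hvol hsub hd hP hen).1 x hx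
      have h2 : inner ℝ x e - inner ℝ z e = ‖x - z‖ := by
        rw [← inner_sub_left, he, real_inner_smul_right, real_inner_self_eq_norm_sq]
        field_simp
      rw [edist_dist]
      refine ENNReal.ofReal_le_ofReal ?_
      have h3 : x - (z + e) = (1 - ‖x - z‖⁻¹) • (x - z) := by
        rw [sub_smul, one_smul, ← he]
        abel
      have h4 : ‖x - z‖⁻¹ ≤ 1 := inv_le_one_of_one_le₀ hxz.le
      rw [dist_eq_norm, h3, norm_smul, Real.norm_of_nonneg (by linarith), sub_mul,
        inv_mul_cancel₀ hn]
      change inner ℝ x e ≤ inner ℝ z e + 1 + 25 * √d at h1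
      linarith
  · by_cases hyE : y ∈ E
    · exact ⟨y, hyE, by simp⟩
    obtain ⟨p, hp, e, hen, -, hyp, hmax⟩ := exists_unit_normal hE.isClosed hconv hEne hyE
    refine ⟨p, hp, ?_⟩
    rw [edist_dist]
    refine ENNReal.ofReal_le_ofReal ?_
    obtain ⟨q, hq, hqe⟩ := (exists_inner_sub_le hE hconv hne hvol hsub hd hP hen).2
    have h1 := hmax q hq
    have h2 : inner ℝ y e - inner ℝ p e = ‖y - p‖ := by
      rw [← inner_sub_left, hyp, real_inner_smul_left, real_inner_self_eq_norm_sq, hen, one_pow,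
        mul_one, ← hyp]
    have h3 : inner ℝ y e - inner ℝ z e ≤ 1 := by
      rw [← inner_sub_left]
      refine (real_inner_le_norm _ _).trans ?_
      rw [hen, mul_one, ← dist_eq_norm]
      exact hy
    rw [dist_eq_norm]
    change inner ℝ z e + 1 - 25 * √d ≤ inner ℝ q e at hqe
    linarith

/-! ### Members of the convex cone class -/

theorem areaRadius_eq_one {E : Set Plane} (h : volume E = ENNReal.ofReal Real.pi) :
    areaRadius E = 1 := by
  rw [areaRadius, h, ENNReal.toReal_ofReal Real.pi_nonneg, div_self Real.pi_ne_zero, Real.sqrt_one]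

theorem mem_convexConeClass_iff {R : ℝ} {E : Set Plane} :
    E ∈ convexConeClass R ↔ IsClosed E ∧ Convex ℝ E ∧ volume E = ENNReal.ofReal Real.pi ∧
      InteriorCone E R (Real.pi / 2) := by
  constructor
  · rintro ⟨⟨h1, -, h2⟩, h3, h4⟩
    rw [areaRadius_eq_one h4, mul_one] at h2
    exact ⟨h1, h3, h4, h2⟩
  · rintro ⟨h1, h3, h4, h2⟩
    refine ⟨⟨h1, by simp [h4], ?_⟩, h3, h4⟩
    rwa [areaRadius_eq_one h4, mul_one]

theorem mem_sector_iff {x ν y : Plane} {R : ℝ} : y ∈ sector x ν R (Real.pi / 2) ↔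
    ‖y - x‖ < R ∧ √2 / 2 * ‖y - x‖ < inner ℝ (y - x) ν := by
  have : Real.pi / 2 / 2 = Real.pi / 4 := by ring
  rw [sector, this, Real.cos_pi_div_four]
  rfl

/-- The sector contains a disc; the radius `R / 16` is small enough because
`√2 / 2 * (1 / 2 + 1 / 16) < 1 / 2 - 1 / 16`. -/
theorem ball_subset_sector {x ν : Plane} {R : ℝ} (hR : 0 < R) (hν : ‖ν‖ = 1) :
    ball (x + (R / 2) • ν) (R / 16) ⊆ sector x ν R (Real.pi / 2) := by
  intro y hy
  rw [mem_sector_iff]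
  rw [mem_ball, dist_eq_norm] at hy
  set v := y - (x + (R / 2) • ν) with hv
  have hyx : y - x = (R / 2) • ν + v := by rw [hv]; abel
  have h1 : ‖y - x‖ ≤ R / 2 + ‖v‖ := by
    rw [hyx]
    refine (norm_add_le _ _).trans_eq ?_
    rw [norm_smul, hν, mul_one, Real.norm_of_nonneg (by positivity)]
  have h2 : inner ℝ (y - x) ν = R / 2 + inner ℝ v ν := by
    rw [hyx, inner_add_left, real_inner_smul_left, real_inner_self_eq_norm_sq, hν]
    ring
  have h3 : -‖v‖ ≤ inner ℝ v ν := by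
    have := (abs_le.1 (abs_real_inner_le_norm v ν)).1
    rwa [hν, mul_one] at this
  have h4 : √2 / 2 ≤ 3 / 4 := by
    have : √2 ≤ 3 / 2 := Real.sqrt_le_iff.2 ⟨by norm_num, by norm_num⟩
    linarith
  refine ⟨by linarith, ?_⟩
  have h5 : √2 / 2 * ‖y - x‖ ≤ 3 / 4 * (R / 2 + ‖v‖) := by gcongr
  linarith

theorem frontier_nonempty_of_volume_eq {E : Set Plane}
    (h : volume E = ENNReal.ofReal Real.pi) : (frontier E).Nonempty := by
  rw [nonempty_frontier_iff]
  refine ⟨?_, ?_⟩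
  · rw [Set.nonempty_iff_ne_empty]
    rintro rfl
    rw [measure_empty, eq_comm, ENNReal.ofReal_eq_zero] at h
    linarith [Real.pi_pos]
  · rintro rfl
    simp at h

theorem exists_ball_subset {R : ℝ} (hR : 0 < R) {E : Set Plane} (hE : E ∈ convexConeClass R) :
    ∃ c, ball c (R / 16) ⊆ E := by
  obtain ⟨-, -, hvol, hcone⟩ := mem_convexConeClass_iff.1 hE
  obtain ⟨x, hx⟩ := frontier_nonempty_of_volume_eq hvol
  obtain ⟨ν, hν, hs⟩ := hcone x hx
  exact ⟨_, (ball_subset_sector hR hν).trans hs⟩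

theorem volumeReal_eq_pi {E : Set Plane} (h : volume E = ENNReal.ofReal Real.pi) :
    volume.real E = Real.pi := by
  rw [Measure.real, h, ENNReal.toReal_ofReal Real.pi_nonneg]

/-- A convex set of area `π` containing a disc of radius `ρ` is bounded in terms of `ρ`: a far away
point would span a long strip together with the disc. -/
theorem subset_closedBall_of_ball_subset {E : Set Plane} (hconv : Convex ℝ E)
    (hvol : volume E = ENNReal.ofReal Real.pi) {c : Plane} {ρ : ℝ} (hρ : 0 < ρ)
    (hball : ball c ρ ⊆ E) : E ⊆ closedBall c (4 * Real.pi / ρ) := by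
  intro y hy
  rw [mem_closedBall, dist_eq_norm]
  by_cases hyc : ‖y - c‖ = 0
  · rw [hyc]
    have := Real.pi_pos
    positivity
  set l := ‖y - c‖ with hl
  have hl0 : 0 < l := lt_of_le_of_ne (norm_nonneg _) (Ne.symm hyc)
  obtain ⟨b, hb⟩ := exists_basis_zero_eq (e := l⁻¹ • (y - c))
    (by rw [norm_smul, norm_inv, Real.norm_of_nonneg hl0.le, ← hl, inv_mul_cancel₀ hyc])
  have hyl : y = c + l • b 0 := by
    rw [hb, smul_smul, mul_inv_cancel₀ hyc, one_smul]
    abel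
  set sc := inner ℝ c (b 0) with hsc
  set tc := inner ℝ c (b 1) with htc
  have hstrip := setIntegral_strip b (g := fun _ => (1 : ℝ)) continuous_const
    (m := fun _ => tc) continuous_const (s₁ := sc) (s₂ := sc + l / 2) (δ := ρ / 4)
    (by linarith) (by positivity)
  set Q := {x : Plane | inner ℝ x (b 0) ∈ Set.Icc sc (sc + l / 2) ∧ |inner ℝ x (b 1) - tc| ≤ ρ / 4}
    with hQ
  have hQE : Q ⊆ E := by
    intro x hx
    obtain ⟨hx1, hx2⟩ := hx
    set θ := (inner ℝ x (b 0) - sc) / l with hθ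
    have hθ0 : 0 ≤ θ := div_nonneg (by linarith [hx1.1]) hl0.le
    have hθ1 : θ ≤ 1 / 2 := by
      rw [hθ, div_le_iff₀ hl0]
      linarith [hx1.2]
    have hθl : θ * l = inner ℝ x (b 0) - sc := div_mul_cancel₀ _ hyc
    set v := (1 - θ)⁻¹ • ((inner ℝ x (b 1) - tc) • b 1) with hv
    have h1θ : 0 < 1 - θ := by linarith
    have hvn : ‖v‖ < ρ := by
      rw [hv, norm_smul, norm_smul, b.orthonormal.1 1, mul_one, norm_inv,
        Real.norm_of_nonneg h1θ.le, Real.norm_eq_abs, inv_mul_lt_iff₀ h1θ]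
      nlinarith
    have hxeq : x = (1 - θ) • (c + v) + θ • y := by
      have hxr : x = inner ℝ x (b 0) • b 0 + inner ℝ x (b 1) • b 1 := by
        conv_lhs => rw [← b.sum_repr' x, Fin.sum_univ_two]
        rw [real_inner_comm, real_inner_comm x (b 1)]
      have hcr : c = sc • b 0 + tc • b 1 := by
        conv_lhs => rw [← b.sum_repr' c, Fin.sum_univ_two]
        rw [real_inner_comm, real_inner_comm c (b 1)]
      rw [hyl, hv, smul_add, smul_smul, mul_inv_cancel₀ h1θ.ne', one_smul, smul_add, smul_smul, hθl]
      calc x = inner ℝ x (b 0) • b 0 + inner ℝ x (b 1) • b 1 := hxr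
        _ = (sc • b 0 + tc • b 1) + (inner ℝ x (b 1) - tc) • b 1
            + (inner ℝ x (b 0) - sc) • b 0 := by module
        _ = c + (inner ℝ x (b 1) - tc) • b 1 + (inner ℝ x (b 0) - sc) • b 0 := by rw [← hcr]
        _ = _ := by module
    rw [hxeq]
    exact hconv (hball (by simpa using hvn)) hy h1θ.le hθ0 (by ring)
  have hfin : volume E ≠ ⊤ := by simp [hvol]
  have hle : volume.real Q ≤ Real.pi :=
    (measureReal_mono hQE hfin).trans_eq (volumeReal_eq_pi hvol)
  rw [setIntegral_const, smul_eq_mul, mul_one] at hstrip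
  simp only [intervalIntegral.integral_const, smul_eq_mul, mul_one] at hstrip
  rw [hstrip] at hle
  rw [le_div_iff₀ hρ]
  nlinarith

theorem isCompact_of_mem {R : ℝ} (hR : 0 < R) {E : Set Plane} (hE : E ∈ convexConeClass R) :
    IsCompact E := by
  obtain ⟨c, hc⟩ := exists_ball_subset hR hE
  obtain ⟨hcl, hconv, hvol, -⟩ := mem_convexConeClass_iff.1 hE
  exact (isCompact_closedBall c _).of_isClosed_subset hcl
    (subset_closedBall_of_ball_subset hconv hvol (by positivity) hc)

theorem interior_nonempty_of_mem {R : ℝ} (hR : 0 < R) {E : Set Plane}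
    (hE : E ∈ convexConeClass R) : (interior E).Nonempty := by
  obtain ⟨c, hc⟩ := exists_ball_subset hR hE
  exact ⟨c, interior_maximal hc isOpen_ball (mem_ball_self (by positivity))⟩

theorem hausdorffAsymmetry_eq {E : Set Plane} (h : volume E = ENNReal.ofReal Real.pi) :
    hausdorffAsymmetry E = ⨅ z : Plane, hausdorffEDist E (closedBall z 1) := by
  simp [hausdorffAsymmetry, areaRadius_eq_one h]

/-! ### Translation invariance -/

theorem perimeter_image_add_right_le (E : Set Plane) (v : Plane) :
    perimeter (IsometryEquiv.addRight v '' E) ≤ perimeter E := by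
  refine perimeter_le fun φ h1 h2 h3 => ?_
  have hmp : MeasurePreserving (fun x : Plane => x + v) := measurePreserving_add_right volume v
  have hemb : MeasurableEmbedding (fun x : Plane => x + v) := measurableEmbedding_addRight v
  have hset : IsometryEquiv.addRight v '' E = (fun x : Plane => x + v) '' E := rfl
  rw [hset, hmp.setIntegral_image_emb hemb]
  have hdiv : ∀ x, divergence φ (x + v) = divergence (fun y => φ (y + v)) x := fun x => by
    simp only [divergence, fderiv_comp_add_right]
  simp only [hdiv]
  refine ofReal_le_perimeter (h1.comp (contDiff_id.add contDiff_const)) ?_ fun x => h3 _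
  exact h2.comp_homeomorph (Homeomorph.addRight v)

theorem volume_image_add_right (E : Set Plane) (v : Plane) :
    volume (IsometryEquiv.addRight v '' E) = volume E := by
  rw [← (measurePreserving_add_right volume v).measure_preimage_emb
    (measurableEmbedding_addRight v) (IsometryEquiv.addRight v '' E)]
  exact congrArg volume (Set.preimage_image_eq E (IsometryEquiv.addRight v).injective)

theorem hausdorffAsymmetry_image_add_right {E : Set Plane}
    (h : volume E = ENNReal.ofReal Real.pi) (v : Plane) :
    hausdorffAsymmetry (IsometryEquiv.addRight v '' E) = hausdorffAsymmetry E := by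
  have hv : volume (IsometryEquiv.addRight v '' E) = ENNReal.ofReal Real.pi := by
    rw [volume_image_add_right, h]
  rw [hausdorffAsymmetry_eq h, hausdorffAsymmetry_eq hv]
  refine (Equiv.iInf_congr (Equiv.addRight v) fun z => ?_).symm
  rw [← hausdorffEDist_image (s := E) (IsometryEquiv.addRight v).isometry,
    IsometryEquiv.image_closedBall]
  rfl

theorem image_add_right_mem {R : ℝ} {E : Set Plane} (hE : E ∈ convexConeClass R) (v : Plane) :
    IsometryEquiv.addRight v '' E ∈ convexConeClass R := by
  obtain ⟨hcl, hconv, hvol, hcone⟩ := mem_convexConeClass_iff.1 hE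
  refine mem_convexConeClass_iff.2 ⟨?_, ?_, ?_, ?_⟩
  · exact (IsometryEquiv.addRight v).toHomeomorph.isClosedMap E hcl
  · have := hconv.translate v
    simp only [add_comm v] at this
    exact this
  · rw [volume_image_add_right, hvol]
  · intro x hx
    have hfr : frontier (IsometryEquiv.addRight v '' E) = IsometryEquiv.addRight v '' frontier E :=
      ((IsometryEquiv.addRight v).toHomeomorph.image_frontier E).symm
    rw [hfr] at hx
    obtain ⟨x', hx', rfl⟩ := hx
    obtain ⟨ν, hν, hs⟩ := hcone x' hx'
    refine ⟨ν, hν, fun y hy => ⟨y - v, hs ?_, by simp⟩⟩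
    rw [mem_sector_iff] at hy ⊢
    have : y - v - x' = y - IsometryEquiv.addRight v x' := by simp; abel
    rwa [this]

/-! ### Hausdorff limits of convex sets -/

section HausdorffLimit

variable {E : ℕ → Set Plane} {K : Set Plane}

theorem eventually_close_of_tendsto (h : Tendsto (fun n => hausdorffEDist (E n) K) atTop (𝓝 0))
    {ε : ℝ} (hε : 0 < ε) : ∀ᶠ n in atTop,
      (∀ x ∈ K, ∃ y ∈ E n, dist x y < ε) ∧ ∀ y ∈ E n, ∃ x ∈ K, dist y x < ε := by
  filter_upwards [h.eventually (gt_mem_nhds (ENNReal.ofReal_pos.2 hε))] with n hn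
  constructor
  · intro x hx
    rw [hausdorffEDist_comm] at hn
    obtain ⟨y, hy, hxy⟩ := exists_edist_lt_of_hausdorffEDist_lt hx hn
    exact ⟨y, hy, by rwa [edist_dist, ENNReal.ofReal_lt_ofReal_iff hε] at hxy⟩
  · intro y hy
    obtain ⟨x, hx, hxy⟩ := exists_edist_lt_of_hausdorffEDist_lt hy hn
    exact ⟨x, hx, by rwa [edist_dist, ENNReal.ofReal_lt_ofReal_iff hε] at hxy⟩

theorem eventually_notMem_of_notMem (h : Tendsto (fun n => hausdorffEDist (E n) K) atTop (𝓝 0))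
    (hK : IsClosed K) {y : Plane} (hy : y ∉ K) : ∀ᶠ n in atTop, y ∉ E n := by
  obtain ⟨ε, hε, hball⟩ := Metric.isOpen_iff.1 hK.isOpen_compl y hy
  filter_upwards [eventually_close_of_tendsto h hε] with n hn hyn
  obtain ⟨x, hx, hxy⟩ := hn.2 y hyn
  exact hball (by rwa [mem_ball, dist_comm]) hx

theorem convex_of_tendsto (h : Tendsto (fun n => hausdorffEDist (E n) K) atTop (𝓝 0))
    (hK : IsClosed K) (hconv : ∀ n, Convex ℝ (E n)) : Convex ℝ K := by
  intro x hx y hy a b ha hb hab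
  by_contra hz
  obtain ⟨ε, hε, hball⟩ := Metric.isOpen_iff.1 hK.isOpen_compl _ hz
  obtain ⟨n, hn1, hn2⟩ := (eventually_close_of_tendsto h (half_pos hε)).exists
  obtain ⟨x', hx', hxx⟩ := hn1 x hx
  obtain ⟨y', hy', hyy⟩ := hn1 y hy
  obtain ⟨w, hw, hww⟩ := hn2 _ (hconv n hx' hy' ha hb hab)
  refine (show w ∉ Kᶜ from fun hc => hc hw) (hball ?_)
  have h1 : dist (a • x + b • y) (a • x' + b • y') ≤ ε / 2 := by
    refine (dist_add_add_le _ _ _ _).trans ?_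
    rw [dist_smul₀, dist_smul₀, Real.norm_of_nonneg ha, Real.norm_of_nonneg hb]
    have e1 : a * dist x x' ≤ a * (ε / 2) := by gcongr
    have e2 : b * dist y y' ≤ b * (ε / 2) := by gcongr
    calc _ ≤ (a + b) * (ε / 2) := by linarith
      _ = ε / 2 := by rw [hab, one_mul]
  rw [mem_ball, dist_comm]
  linarith [dist_triangle (a • x + b • y) (a • x' + b • y') w]

/-- Interior points of the limit lie in the approximating convex sets: otherwise a half-plane
containing the approximating set would miss a disc of the limit. -/
theorem eventually_mem_of_mem_interior
    (h : Tendsto (fun n => hausdorffEDist (E n) K) atTop (𝓝 0))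
    (hcl : ∀ n, IsClosed (E n)) (hconv : ∀ n, Convex ℝ (E n)) {y : Plane}
    (hy : y ∈ interior K) : ∀ᶠ n in atTop, y ∈ E n := by
  obtain ⟨r, hr, hball⟩ := Metric.isOpen_iff.1 isOpen_interior y hy
  filter_upwards [eventually_close_of_tendsto h (half_pos hr)] with n hn
  by_contra hyn
  obtain ⟨y', hy', -⟩ := hn.1 y (interior_subset hy)
  obtain ⟨p, hp, e, he, hpos, hype, hmax⟩ := exists_unit_normal (hcl n) (hconv n) ⟨y', hy'⟩ hyn
  have hw : y + (r / 2) • e ∈ K := interior_subset (hball (by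
    rw [mem_ball, dist_eq_norm, add_sub_cancel_left, norm_smul, he, mul_one,
      Real.norm_of_nonneg (by positivity)]
    linarith))
  obtain ⟨x, hx, hxd⟩ := hn.1 _ hw
  have h1 := hmax x hx
  have h2 : inner ℝ y e - inner ℝ p e = ‖y - p‖ := by
    rw [← inner_sub_left, hype, real_inner_smul_left, real_inner_self_eq_norm_sq, he, one_pow,
      mul_one, ← hype]
  have h3 := real_inner_le_norm (y + (r / 2) • e - x) e
  rw [he, mul_one, ← dist_eq_norm, inner_sub_left, inner_add_left, real_inner_smul_left,
    real_inner_self_eq_norm_sq, he] at h3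
  linarith

/-- Indicators converge off the boundary of the limit, which is a null set by convexity. -/
theorem tendsto_setIntegral_of_tendsto
    (h : Tendsto (fun n => hausdorffEDist (E n) K) atTop (𝓝 0))
    (hcl : ∀ n, IsClosed (E n)) (hconv : ∀ n, Convex ℝ (E n)) {L : ℝ}
    (hL : ∀ n, E n ⊆ closedBall 0 L) (hK : IsClosed K) {f : Plane → ℝ} (hf : Continuous f) :
    Tendsto (fun n => ∫ x in E n, f x) atTop (𝓝 (∫ x in K, f x)) := by
  simp only [← integral_indicator (hcl _).measurableSet, ← integral_indicator hK.measurableSet]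
  refine tendsto_integral_of_dominated_convergence ((closedBall 0 L).indicator fun x => ‖f x‖)
    (fun n => hf.aestronglyMeasurable.indicator (hcl n).measurableSet) ?_ (fun n => ?_) ?_
  · have hi := hf.norm.continuousOn.integrableOn_compact (μ := volume)
      (isCompact_closedBall (0 : Plane) L)
    exact hi.integrable_indicator measurableSet_closedBall
  · refine ae_of_all _ fun x => ?_
    rw [norm_indicator_eq_indicator_norm]
    exact Set.indicator_le_indicator_of_subset (hL n) (fun _ => norm_nonneg _) x
  · have hfr : volume (frontier K) = 0 := (convex_of_tendsto h hK hconv).addHaar_frontier volume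
    filter_upwards [measure_eq_zero_iff_ae_notMem.1 hfr] with x hx
    by_cases hxK : x ∈ K
    · have hxi : x ∈ interior K := by
        by_contra hxi
        exact hx (by rw [hK.frontier_eq]; exact ⟨hxK, hxi⟩)
      refine tendsto_const_nhds.congr' ?_
      filter_upwards [eventually_mem_of_mem_interior h hcl hconv hxi] with n hn
      rw [Set.indicator_of_mem hxK, Set.indicator_of_mem hn]
    · refine tendsto_const_nhds.congr' ?_
      filter_upwards [eventually_notMem_of_notMem h hK hxK] with n hn
      rw [Set.indicator_of_notMem hxK, Set.indicator_of_notMem hn]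

/-- Lower semicontinuity of the perimeter. -/
theorem perimeter_le_of_tendsto
    (h : Tendsto (fun n => hausdorffEDist (E n) K) atTop (𝓝 0))
    (hcl : ∀ n, IsClosed (E n)) (hconv : ∀ n, Convex ℝ (E n)) {L : ℝ}
    (hL : ∀ n, E n ⊆ closedBall 0 L) (hK : IsClosed K) {c : ℕ → ENNReal} {c' : ENNReal}
    (hc : Tendsto c atTop (𝓝 c')) (hle : ∀ n, perimeter (E n) ≤ c n) : perimeter K ≤ c' :=
  perimeter_le fun _ h1 h2 h3 => le_of_tendsto_of_tendsto'
    (ENNReal.tendsto_ofReal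
      (tendsto_setIntegral_of_tendsto h hcl hconv hL hK (continuous_divergence h1)))
    hc fun n => (ofReal_le_perimeter h1 h2 h3).trans (hle n)

theorem volume_eq_of_tendsto
    (h : Tendsto (fun n => hausdorffEDist (E n) K) atTop (𝓝 0))
    (hcl : ∀ n, IsClosed (E n)) (hconv : ∀ n, Convex ℝ (E n)) {L : ℝ}
    (hL : ∀ n, E n ⊆ closedBall 0 L) (hK : IsCompact K)
    (hvol : ∀ n, volume (E n) = ENNReal.ofReal Real.pi) : volume K = ENNReal.ofReal Real.pi := by
  have h1 := tendsto_setIntegral_of_tendsto h hcl hconv hL hK.isClosed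
    (continuous_const (y := (1 : ℝ)))
  simp only [setIntegral_const, volumeReal_eq_pi (hvol _), smul_eq_mul, mul_one] at h1
  rw [tendsto_nhds_unique tendsto_const_nhds h1, Measure.real,
    ENNReal.ofReal_toReal hK.measure_lt_top.ne]

theorem tendsto_hausdorffAsymmetry
    (h : Tendsto (fun n => hausdorffEDist (E n) K) atTop (𝓝 0))
    (hvol : ∀ n, volume (E n) = ENNReal.ofReal Real.pi) (hvK : volume K = ENNReal.ofReal Real.pi)
    (hfin : hausdorffAsymmetry K ≠ ⊤) :
    Tendsto (fun n => hausdorffAsymmetry (E n)) atTop (𝓝 (hausdorffAsymmetry K)) := by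
  have key : ∀ {A B : Set Plane}, volume A = ENNReal.ofReal Real.pi →
      volume B = ENNReal.ofReal Real.pi →
      hausdorffAsymmetry A ≤ hausdorffAsymmetry B + hausdorffEDist A B := by
    intro A B hA hB
    rw [hausdorffAsymmetry_eq hA, hausdorffAsymmetry_eq hB, ENNReal.iInf_add]
    refine le_iInf fun z => (iInf_le _ z).trans ?_
    rw [add_comm]
    exact hausdorffEDist_triangle
  have hlow := ENNReal.Tendsto.sub (tendsto_const_nhds (x := hausdorffAsymmetry K)) h (.inl hfin)
  have hupp := (tendsto_const_nhds (x := hausdorffAsymmetry K)).add h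
  rw [tsub_zero] at hlow
  rw [add_zero] at hupp
  refine tendsto_of_tendsto_of_tendsto_of_le_of_le hlow hupp (fun n => ?_) fun n => ?_
  · dsimp only
    rw [tsub_le_iff_right, hausdorffEDist_comm]
    exact key hvK (hvol n)
  · exact key (hvol n) hvK

/-- Boundary points of the limit are limits of boundary points. -/
theorem eventually_exists_mem_frontier
    (h : Tendsto (fun n => hausdorffEDist (E n) K) atTop (𝓝 0))
    (hcl : ∀ n, IsClosed (E n)) (hconv : ∀ n, Convex ℝ (E n)) (hK : IsClosed K)
    (hint : (interior K).Nonempty) {x : Plane} (hx : x ∈ frontier K) {ε : ℝ} (hε : 0 < ε) :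
    ∀ᶠ n in atTop, ∃ y ∈ frontier (E n), dist y x < ε := by
  have hconvK := convex_of_tendsto h hK hconv
  have hxcl : x ∈ closure (interior K) := by
    rw [hconvK.closure_interior_eq_closure_of_nonempty_interior hint]
    exact frontier_subset_closure hx
  obtain ⟨y, hy, hxy⟩ := Metric.mem_closure_iff.1 hxcl ε hε
  have hxcl' : x ∈ closure Kᶜ := by
    rw [frontier_eq_closure_inter_closure] at hx
    exact hx.2
  obtain ⟨w, hw, hxw⟩ := Metric.mem_closure_iff.1 hxcl' ε hε
  filter_upwards [eventually_mem_of_mem_interior h hcl hconv hy,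
    eventually_notMem_of_notMem h hK hw] with n hyn hwn
  by_contra! hno
  -- otherwise the ball would be split by the interior and the exterior of `E n`
  obtain ⟨v, -, hv1, hv2⟩ := (convex_ball x ε).isPreconnected (interior (E n)) (E n)ᶜ
    isOpen_interior (hcl n).isOpen_compl (fun v hv => by
      by_cases hvE : v ∈ E n
      · left
        by_contra hvi
        exact (hno v (by rw [(hcl n).frontier_eq]; exact ⟨hvE, hvi⟩)).not_gt hv
      · exact Or.inr hvE)
    ⟨y, by rwa [mem_ball, dist_comm], by
      by_contra hvi
      refine (hno y (by rw [(hcl n).frontier_eq]; exact ⟨hyn, hvi⟩)).not_gt ?_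
      rwa [dist_comm]⟩
    ⟨w, by rwa [mem_ball, dist_comm], hwn⟩
  exact hv2 (interior_subset hv1)

/-- The interior cone condition is closed under Hausdorff convergence: the axes at nearby boundary
points subconverge on the unit circle, and sectors are open. -/
theorem interiorCone_of_tendsto
    (h : Tendsto (fun n => hausdorffEDist (E n) K) atTop (𝓝 0))
    (hcl : ∀ n, IsClosed (E n)) (hconv : ∀ n, Convex ℝ (E n)) (hK : IsClosed K)
    (hint : (interior K).Nonempty) {R : ℝ} (hcone : ∀ n, InteriorCone (E n) R (Real.pi / 2)) :
    InteriorCone K R (Real.pi / 2) := by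
  intro x hx
  have hex : ∀ j : ℕ, ∃ n, j ≤ n ∧ ∃ y ∈ frontier (E n), dist y x < 1 / ((j : ℝ) + 1) := fun j =>
    ((eventually_ge_atTop j).and (eventually_exists_mem_frontier h hcl hconv hK hint hx
      Nat.one_div_pos_of_nat)).exists
  choose N hN y hy hyx using hex
  choose ν hν hs using fun j => hcone (N j) (y j) (hy j)
  obtain ⟨ν₀, hν₀, ψ, hψ, hlim⟩ := (isCompact_sphere (0 : Plane) 1).tendsto_subseq
    (x := ν) (fun j => by simp [hν j])
  have hylim : Tendsto (fun j => y (ψ j)) atTop (𝓝 x) := by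
    have h1 : Tendsto y atTop (𝓝 x) := tendsto_iff_dist_tendsto_zero.2
      (squeeze_zero (fun _ => dist_nonneg) (fun j => (hyx j).le)
        tendsto_one_div_add_atTop_nhds_zero_nat)
    exact h1.comp hψ.tendsto_atTop
  have hNlim : Tendsto (fun j => N (ψ j)) atTop atTop :=
    (tendsto_atTop_mono hN tendsto_id).comp hψ.tendsto_atTop
  refine ⟨ν₀, by simpa using hν₀, fun w hw => ?_⟩
  by_contra hwK
  rw [mem_sector_iff] at hw
  have hd : Tendsto (fun j => w - y (ψ j)) atTop (𝓝 (w - x)) := tendsto_const_nhds.sub hylim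
  have e1 := hd.norm.eventually (gt_mem_nhds hw.1)
  have e2 := (hd.norm.const_mul (√2 / 2)).eventually_lt (hd.inner hlim) hw.2
  obtain ⟨j, hj1, hj2, hj3⟩ :=
    (e1.and (e2.and (hNlim.eventually (eventually_notMem_of_notMem h hK hwK)))).exists
  exact hj3 (hs (ψ j) (mem_sector_iff.2 ⟨hj1, hj2⟩))

end HausdorffLimit

/-- Blaschke's selection theorem, for nonempty compact subsets of a fixed disc. -/
theorem exists_subseq_tendsto_hausdorffEDist {E : ℕ → Set Plane} (hcl : ∀ n, IsClosed (E n))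
    (hne : ∀ n, (E n).Nonempty) {L : ℝ} (hL : ∀ n, E n ⊆ closedBall 0 L) :
    ∃ (K : Set Plane) (φ : ℕ → ℕ), IsCompact K ∧ K.Nonempty ∧ StrictMono φ ∧
      Tendsto (fun n => hausdorffEDist (E (φ n)) K) atTop (𝓝 0) := by
  have hcpt := TopologicalSpace.NonemptyCompacts.isCompact_subsets_of_isCompact
    (isCompact_closedBall (0 : Plane) L)
  obtain ⟨K, -, φ, hφ, hlim⟩ := hcpt.tendsto_subseq
    (x := fun n => ⟨⟨E n, (isCompact_closedBall _ _).of_isClosed_subset (hcl n) (hL n)⟩, hne n⟩)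
    hL
  refine ⟨K, φ, K.isCompact, K.nonempty, hφ, ?_⟩
  exact tendsto_iff_edist_tendsto_0.1 hlim

theorem hausdorffAsymmetry_ne_top {E : Set Plane} (hE : IsCompact E) (hne : E.Nonempty)
    (hvol : volume E = ENNReal.ofReal Real.pi) : hausdorffAsymmetry E ≠ ⊤ := by
  rw [hausdorffAsymmetry_eq hvol]
  exact ((iInf_le _ 0).trans_lt (hausdorffEDist_ne_top_of_nonempty_of_bounded hne
    ⟨0, by simp⟩ hE.isBounded isBounded_closedBall).lt_top).ne

/-- Compactness of the convex cone class up to translation, with continuity of the asymmetry and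
lower semicontinuity of the perimeter. -/
theorem exists_limit_mem_convexConeClass {R : ℝ} (hR : 0 < R) {E : ℕ → Set Plane}
    (hE : ∀ n, E n ∈ convexConeClass R) :
    ∃ K ∈ convexConeClass R, ∃ φ : ℕ → ℕ, StrictMono φ ∧
      Tendsto (fun n => hausdorffAsymmetry (E (φ n))) atTop (𝓝 (hausdorffAsymmetry K)) ∧
      ∀ (c : ℕ → ENNReal) (c' : ENNReal), Tendsto c atTop (𝓝 c') →
        (∀ n, perimeter (E (φ n)) ≤ c n) → perimeter K ≤ c' := by
  choose x hx using fun n => exists_ball_subset hR (hE n)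
  set F : ℕ → Set Plane := fun n => IsometryEquiv.addRight (-x n) '' E n with hF
  have hFm : ∀ n, F n ∈ convexConeClass R := fun n => image_add_right_mem (hE n) _
  have hFball : ∀ n, ball 0 (R / 16) ⊆ F n := fun n => by
    have h1 := Set.image_mono (f := IsometryEquiv.addRight (-x n)) (hx n)
    rw [IsometryEquiv.image_ball] at h1
    have h2 : IsometryEquiv.addRight (-x n) (x n) = 0 := by simp
    rwa [h2] at h1
  have hcl : ∀ n, IsClosed (F n) := fun n => (mem_convexConeClass_iff.1 (hFm n)).1
  have hconv : ∀ n, Convex ℝ (F n) := fun n => (mem_convexConeClass_iff.1 (hFm n)).2.1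
  have hvol : ∀ n, volume (F n) = ENNReal.ofReal Real.pi :=
    fun n => (mem_convexConeClass_iff.1 (hFm n)).2.2.1
  have hcone : ∀ n, InteriorCone (F n) R (Real.pi / 2) :=
    fun n => (mem_convexConeClass_iff.1 (hFm n)).2.2.2
  have h0 : ∀ n, (0 : Plane) ∈ F n := fun n => hFball n (mem_ball_self (by positivity))
  have hL : ∀ n, F n ⊆ closedBall 0 (4 * Real.pi / (R / 16)) := fun n =>
    subset_closedBall_of_ball_subset (hconv n) (hvol n) (by positivity) (hFball n)
  obtain ⟨K, φ, hK, hKne, hφ, hlim⟩ :=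
    exists_subseq_tendsto_hausdorffEDist hcl (fun n => ⟨0, h0 n⟩) hL
  have hvK := volume_eq_of_tendsto hlim (fun n => hcl _) (fun n => hconv _) (fun n => hL _) hK
    fun n => hvol _
  have hint : (interior K).Nonempty := by
    refine ⟨0, interior_maximal (fun y hy => ?_) isOpen_ball
      (mem_ball_self (by positivity : (0 : ℝ) < R / 16))⟩
    by_contra hyK
    obtain ⟨n, hn⟩ := (eventually_notMem_of_notMem hlim hK.isClosed hyK).exists
    exact hn (hFball _ hy)
  refine ⟨K, mem_convexConeClass_iff.2 ⟨hK.isClosed,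
    convex_of_tendsto hlim hK.isClosed fun n => hconv _, hvK,
    interiorCone_of_tendsto hlim (fun n => hcl _) (fun n => hconv _) hK.isClosed hint
      fun n => hcone _⟩, φ, hφ, ?_, fun c c' hc hle => ?_⟩
  · have := tendsto_hausdorffAsymmetry hlim (fun n => hvol _) hvK
      (hausdorffAsymmetry_ne_top hK hKne hvK)
    simpa only [hF, hausdorffAsymmetry_image_add_right (mem_convexConeClass_iff.1 (hE _)).2.2.1]
      using this
  · exact perimeter_le_of_tendsto hlim (fun n => hcl _) (fun n => hconv _) (fun n => hL _)
      hK.isClosed hc fun n => (perimeter_image_add_right_le _ _).trans (hle n)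

/-! ### Vanishing asymmetry characterises discs -/

theorem hausdorffEDist_closedBall_le (z w : Plane) :
    hausdorffEDist (closedBall z 1) (closedBall w 1) ≤ edist z w := by
  have key : ∀ a b : Plane, ∀ x ∈ closedBall a 1, ∃ y ∈ closedBall b 1, edist x y ≤ edist a b := by
    intro a b x hx
    refine ⟨x + (b - a), ?_, ?_⟩
    · rw [mem_closedBall, dist_eq_norm] at hx ⊢
      rwa [show x + (b - a) - b = x - a by abel]
    · rw [edist_dist, edist_dist, dist_eq_norm, dist_eq_norm]
      exact le_of_eq (by congr 2; abel)
  refine hausdorffEDist_le_of_mem_edist (key z w) fun x hx => ?_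
  rw [edist_comm z w]
  exact key w z x hx

theorem isBall_of_hausdorffAsymmetry_eq_zero {E : Set Plane} (hE : IsCompact E)
    (hvol : volume E = ENNReal.ofReal Real.pi) (h : hausdorffAsymmetry E = 0) : IsBall E := by
  rw [hausdorffAsymmetry_eq hvol] at h
  have hex : ∀ n : ℕ, ∃ z, hausdorffEDist E (closedBall z 1)
      < ENNReal.ofReal (1 / ((n : ℝ) + 1)) := fun n => by
    rw [← iInf_lt_iff, h]
    exact ENNReal.ofReal_pos.2 Nat.one_div_pos_of_nat
  choose z hz using hex
  have hzmem : ∀ n, z n ∈ cthickening 1 E := fun n => by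
    rw [mem_cthickening_iff]
    have h1 : z n ∈ closedBall (z n) 1 := mem_closedBall_self zero_le_one
    refine (infEDist_le_hausdorffEDist_of_mem h1).trans ?_
    rw [hausdorffEDist_comm]
    refine (hz n).le.trans (ENNReal.ofReal_le_ofReal ?_)
    rw [div_le_one (by positivity)]
    linarith [n.cast_nonneg (α := ℝ)]
  obtain ⟨w, -, φ, hφ, hlim⟩ := hE.cthickening.tendsto_subseq hzmem
  refine ⟨w, 1, ?_⟩
  rw [← hE.isClosed.hausdorffEDist_zero_iff isClosed_closedBall]
  have hup : Tendsto (fun n => ENNReal.ofReal (1 / ((φ n : ℝ) + 1)) + edist (z (φ n)) w) atTop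
      (𝓝 (ENNReal.ofReal 0 + 0)) :=
    (ENNReal.tendsto_ofReal (tendsto_one_div_add_atTop_nhds_zero_nat.comp hφ.tendsto_atTop)).add
      (tendsto_iff_edist_tendsto_0.1 hlim)
  rw [ENNReal.ofReal_zero, add_zero] at hup
  refine le_antisymm (ge_of_tendsto' hup fun n => ?_) bot_le
  refine (hausdorffEDist_triangle (t := closedBall (z (φ n)) 1)).trans ?_
  exact add_le_add (hz _).le (hausdorffEDist_closedBall_le _ _)

theorem hausdorffAsymmetry_eq_zero_of_isBall {E : Set Plane}
    (hvol : volume E = ENNReal.ofReal Real.pi) (h : IsBall E) : hausdorffAsymmetry E = 0 := by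
  obtain ⟨z, r, rfl⟩ := h
  have hr : 0 ≤ r := by
    by_contra! hr
    rw [closedBall_eq_empty.2 hr, measure_empty, eq_comm, ENNReal.ofReal_eq_zero] at hvol
    linarith [Real.pi_pos]
  have h1 := volumeReal_eq_pi hvol
  rw [volume_real_closedBall z hr] at h1
  have h2 : r ^ 2 = 1 := by
    have := Real.pi_pos
    exact mul_left_cancel₀ this.ne' (h1.trans (mul_one _).symm)
  have h3 : r = 1 := by nlinarith
  subst h3
  rw [hausdorffAsymmetry_eq hvol]
  exact le_antisymm ((iInf_le _ z).trans_eq hausdorffEDist_self) bot_le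

/-! ### The shape functional -/

theorem shapeFunctional_eq {E : Set Plane} (hvol : volume E = ENNReal.ofReal Real.pi) {p l : ℝ}
    (hp0 : 0 ≤ p) (hp : perimeter E = ENNReal.ofReal p) (hl0 : 0 ≤ l)
    (hl : hausdorffAsymmetry E = ENNReal.ofReal l) :
    shapeFunctional E = (((p - 2 * Real.pi) / (2 * Real.pi) / l ^ 2 : ℝ) : EReal) := by
  have hpi : 0 ≤ 2 * Real.pi := by positivity
  rw [shapeFunctional, deficit, areaRadius_eq_one hvol, perimeter_unit_closedBall, hp, hl,
    ← ENNReal.ofReal_pow hl0, EReal.coe_ennreal_ofReal, EReal.coe_ennreal_ofReal,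
    EReal.coe_ennreal_ofReal, max_eq_left hp0, max_eq_left hpi, max_eq_left (by positivity)]
  rw [← EReal.coe_sub, ← EReal.coe_div, ← EReal.coe_div]

theorem shapeFunctional_eq_top {E : Set Plane} (hvol : volume E = ENNReal.ofReal Real.pi)
    (hp : perimeter E = ⊤) {l : ℝ} (hl0 : 0 < l) (hl : hausdorffAsymmetry E = ENNReal.ofReal l) :
    shapeFunctional E = ⊤ := by
  have hpi : 0 < 2 * Real.pi := by positivity
  rw [shapeFunctional, deficit, areaRadius_eq_one hvol, perimeter_unit_closedBall, hp, hl,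
    ← ENNReal.ofReal_pow hl0.le, EReal.coe_ennreal_ofReal, EReal.coe_ennreal_ofReal,
    max_eq_left hpi.le, max_eq_left (by positivity), EReal.coe_ennreal_top, EReal.top_sub_coe,
    EReal.top_div_of_pos_ne_top (by exact_mod_cast hpi) (EReal.coe_ne_top _),
    EReal.top_div_of_pos_ne_top (by exact_mod_cast pow_pos hl0 2) (EReal.coe_ne_top _)]

/-- Members of the class other than discs have finite positive asymmetry. -/
theorem exists_asymmetry_eq_ofReal {R : ℝ} (hR : 0 < R) {E : Set Plane}
    (hE : E ∈ convexConeClass R) (hball : ¬ IsBall E) :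
    ∃ l : ℝ, 0 < l ∧ hausdorffAsymmetry E = ENNReal.ofReal l := by
  have hcpt := isCompact_of_mem hR hE
  have hvol := (mem_convexConeClass_iff.1 hE).2.2.1
  have hne : E.Nonempty := (interior_nonempty_of_mem hR hE).mono interior_subset
  have htop := hausdorffAsymmetry_ne_top hcpt hne hvol
  have h0 : hausdorffAsymmetry E ≠ 0 := fun h =>
    hball (isBall_of_hausdorffAsymmetry_eq_zero hcpt hvol h)
  exact ⟨_, ENNReal.toReal_pos h0 htop, (ENNReal.ofReal_toReal htop).symm⟩

/-- Sublevel sets of the shape functional in terms of the perimeter. -/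
theorem shapeFunctional_le_iff {E : Set Plane} (hvol : volume E = ENNReal.ofReal Real.pi) {l c : ℝ}
    (hl0 : 0 < l) (hl : hausdorffAsymmetry E = ENNReal.ofReal l) (hc : 0 ≤ c) :
    shapeFunctional E ≤ (c : EReal) ↔
      perimeter E ≤ ENNReal.ofReal (2 * Real.pi * (1 + c * l ^ 2)) := by
  have hpi := Real.pi_pos
  by_cases hp : perimeter E = ⊤
  · rw [shapeFunctional_eq_top hvol hp hl0 hl, hp]
    simp
  · have hp' := (ENNReal.ofReal_toReal hp).symm
    rw [shapeFunctional_eq hvol ENNReal.toReal_nonneg hp' hl0.le hl, EReal.coe_le_coe_iff, hp',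
      ENNReal.ofReal_le_ofReal_iff (by positivity), div_le_iff₀ (by positivity),
      div_le_iff₀ (by positivity), ENNReal.toReal_ofReal ENNReal.toReal_nonneg]
    constructor <;> intro h <;> linarith

theorem shapeFunctional_nonneg {R : ℝ} (hR : 0 < R) {E : Set Plane}
    (hE : E ∈ convexConeClass R) (hball : ¬ IsBall E) : 0 ≤ shapeFunctional E := by
  obtain ⟨l, hl0, hl⟩ := exists_asymmetry_eq_ofReal hR hE hball
  obtain ⟨-, hconv, hvol, -⟩ := mem_convexConeClass_iff.1 hE
  have hpi := Real.pi_pos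
  by_cases hp : perimeter E = ⊤
  · rw [shapeFunctional_eq_top hvol hp hl0 hl]
    exact le_top
  · have hp' := (ENNReal.ofReal_toReal hp).symm
    have hiso := two_pi_le_perimeter (isCompact_of_mem hR hE) hconv
      (interior_nonempty_of_mem hR hE) (volumeReal_eq_pi hvol)
    rw [hp', ENNReal.ofReal_le_ofReal_iff ENNReal.toReal_nonneg] at hiso
    rw [shapeFunctional_eq hvol ENNReal.toReal_nonneg hp' hl0.le hl, ← EReal.coe_zero,
      EReal.coe_le_coe_iff]
    have : 0 ≤ (perimeter E).toReal - 2 * Real.pi := by linarith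
    positivity

/-- Sets close to a disc cannot have a small shape functional. -/
theorem one_le_asymmetry_of_shapeFunctional_le {R : ℝ} (hR : 0 < R) {E : Set Plane}
    (hE : E ∈ convexConeClass R) (hball : ¬ IsBall E) {c : ℝ} (hc0 : 0 ≤ c) (hc : c < 1 / 625)
    (hF : shapeFunctional E ≤ (c : EReal)) : 1 ≤ hausdorffAsymmetry E := by
  obtain ⟨l, hl0, hl⟩ := exists_asymmetry_eq_ofReal hR hE hball
  obtain ⟨-, hconv, hvol, -⟩ := mem_convexConeClass_iff.1 hE
  rw [shapeFunctional_le_iff hvol hl0 hl hc0] at hF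
  by_contra! hlt
  have hlt' := hlt
  rw [hausdorffAsymmetry_eq hvol, iInf_lt_iff] at hlt'
  obtain ⟨z', hz'⟩ := hlt'
  have hsub : E ⊆ closedBall z' 2 := by
    intro x hx
    obtain ⟨y, hy, hxy⟩ := exists_edist_lt_of_hausdorffEDist_lt hx hz'
    rw [edist_dist, ← ENNReal.ofReal_one, ENNReal.ofReal_lt_ofReal_iff zero_lt_one] at hxy
    rw [mem_closedBall] at hy ⊢
    linarith [dist_triangle x y z']
  have hst := hausdorffEDist_barycenter_le (isCompact_of_mem hR hE) hconv
    (interior_nonempty_of_mem hR hE) (volumeReal_eq_pi hvol) hsub (d := c * l ^ 2)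
    (by positivity) hF
  have hle : ENNReal.ofReal l ≤ ENNReal.ofReal (25 * √(c * l ^ 2)) := by
    rw [← hl, hausdorffAsymmetry_eq hvol]
    exact (iInf_le _ _).trans hst
  rw [ENNReal.ofReal_le_ofReal_iff (by positivity), Real.sqrt_mul hc0, Real.sqrt_sq hl0.le] at hle
  have hsq : √c < 1 / 25 := by
    rw [Real.sqrt_lt hc0 (by norm_num)]
    linarith
  nlinarith

/-! ### A thin rectangle -/

/-- The rectangle with centre `0` and half-sides `A`, `B`. -/
def rect (A B : ℝ) : Set Plane := {x | |x 0| ≤ A ∧ |x 1| ≤ B}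

theorem isClosed_rect (A B : ℝ) : IsClosed (rect A B) :=
  (isClosed_le (f := fun x : Plane => |x 0|) (by fun_prop) continuous_const).inter
    (isClosed_le (f := fun x : Plane => |x 1|) (by fun_prop) continuous_const)

theorem volume_rect (A B : ℝ) :
    volume (rect A B) = ENNReal.ofReal (2 * A) * ENNReal.ofReal (2 * B) := by
  have hpre : rect A B = (WithLp.ofLp : Plane → Fin 2 → ℝ) ⁻¹' Set.Icc ![-A, -B] ![A, B] := by
    ext x
    simp only [rect, Set.mem_preimage, Set.mem_Icc, Pi.le_def, Fin.forall_fin_two, abs_le]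
    simp
    tauto
  rw [hpre, (PiLp.volume_preserving_ofLp (Fin 2)).measure_preimage
    measurableSet_Icc.nullMeasurableSet, Real.volume_Icc_pi, Fin.prod_univ_two]
  simp [two_mul]

theorem volumeReal_rect {A B : ℝ} (hA : 0 ≤ A) (hB : 0 ≤ B) :
    volume.real (rect A B) = 4 * A * B := by
  rw [Measure.real, volume_rect, ENNReal.toReal_mul, ENNReal.toReal_ofReal (by positivity),
    ENNReal.toReal_ofReal (by positivity)]
  ring

theorem convex_rect (A B : ℝ) : Convex ℝ (rect A B) := by
  intro x hx y hy a b ha hb hab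
  have key : ∀ {s t C : ℝ}, |s| ≤ C → |t| ≤ C → |a * s + b * t| ≤ C := by
    intro s t C hs ht
    have hs' := abs_le.1 hs
    have ht' := abs_le.1 ht
    have hb' : b = 1 - a := by linarith
    subst hb'
    rw [abs_le]
    constructor <;> nlinarith
  exact ⟨key hx.1 hy.1, key hx.2 hy.2⟩

theorem isCompact_rect {A B : ℝ} (hA : 0 ≤ A) (hB : 0 ≤ B) : IsCompact (rect A B) := by
  refine (isCompact_closedBall (0 : Plane) (A + B)).of_isClosed_subset (isClosed_rect A B) ?_
  intro x hx
  have h0 := abs_le.1 hx.1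
  have h1 := abs_le.1 hx.2
  rw [mem_closedBall, dist_zero_right, EuclideanSpace.norm_eq, Fin.sum_univ_two,
    Real.norm_eq_abs, Real.norm_eq_abs, sq_abs, sq_abs]
  refine Real.sqrt_le_iff.2 ⟨by positivity, ?_⟩
  nlinarith [mul_nonneg hA hB]

theorem perimeter_rect_le {A B : ℝ} (hA : 0 ≤ A) (hB : 0 ≤ B) :
    perimeter (rect A B) ≤ ENNReal.ofReal (4 * (A + B)) := by
  have hcpt := isCompact_rect hA hB
  refine perimeter_le_of_volume_cthickening_le (C' := 4) hcpt ⟨0, by simpa [rect] using ⟨hA, hB⟩⟩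
    fun ε h0 _ => ?_
  have hsub : cthickening ε (rect A B) ⊆ rect (A + ε) (B + ε) := by
    rw [hcpt.cthickening_eq_biUnion_closedBall h0.le]
    refine Set.iUnion₂_subset fun y hy x hx => ?_
    rw [mem_closedBall, dist_eq_norm] at hx
    have key : ∀ i, |x i| ≤ |y i| + ε := fun i => by
      have h1 : |x i - y i| ≤ ‖x - y‖ := PiLp.norm_apply_le (x - y) i
      linarith [abs_sub_abs_le_abs_sub (x i) (y i)]
    exact ⟨(key 0).trans (by linarith [hy.1]), (key 1).trans (by linarith [hy.2])⟩
  refine (measureReal_mono hsub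
    (isCompact_rect (by positivity) (by positivity)).measure_lt_top.ne).trans ?_
  rw [volumeReal_rect (by positivity) (by positivity), volumeReal_rect hA hB]
  exact le_of_eq (by ring)

/-- The corners of a rectangle are right angles, so that the sector of aperture `π / 2` pointing
from any of its points into the opposite quadrant stays inside. -/
theorem interiorCone_rect {A B R : ℝ} (hRA : R ≤ A) (hRB : R ≤ B) :
    InteriorCone (rect A B) R (Real.pi / 2) := by
  intro x hx
  have hxr : x ∈ rect A B := (isClosed_rect A B).frontier_subset hx
  have hsign : ∀ a : ℝ, ∃ σ : ℝ, σ ^ 2 = 1 ∧ ∀ (d C : ℝ), |a| ≤ C → R ≤ C → |d| < R → 0 < σ * d →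
      |a + d| ≤ C := by
    intro a
    by_cases ha : 0 ≤ a
    · refine ⟨-1, by norm_num, fun d C h1 h2 h3 h4 => ?_⟩
      rw [abs_le] at h1 ⊢
      rw [abs_lt] at h3
      constructor <;> linarith
    · refine ⟨1, by norm_num, fun d C h1 h2 h3 h4 => ?_⟩
      rw [abs_le] at h1 ⊢
      rw [abs_lt] at h3
      constructor <;> linarith
  obtain ⟨σ₀, hσ₀, h₀⟩ := hsign (x 0)
  obtain ⟨σ₁, hσ₁, h₁⟩ := hsign (x 1)
  have hsq2 : (√2 / 2) ^ 2 = 1 / 2 := by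
    rw [div_pow, Real.sq_sqrt (by norm_num)]
    norm_num
  have hs2 : 0 < √2 / 2 := by positivity
  refine ⟨!₂[σ₀ * (√2 / 2), σ₁ * (√2 / 2)], ?_, fun y hy => ?_⟩
  · rw [EuclideanSpace.norm_eq, Fin.sum_univ_two, Real.norm_eq_abs, Real.norm_eq_abs, sq_abs,
      sq_abs]
    simp only [Matrix.cons_val_zero, Matrix.cons_val_one, mul_pow, hσ₀, hσ₁, hsq2]
    norm_num
  · rw [mem_sector_iff] at hy
    set d := y - x with hd
    obtain ⟨hy1, hy2⟩ := hy
    have hin : inner ℝ d !₂[σ₀ * (√2 / 2), σ₁ * (√2 / 2)]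
        = √2 / 2 * (σ₀ * d 0 + σ₁ * d 1) := by
      simp [PiLp.inner_apply, Fin.sum_univ_two]
      ring
    rw [hin] at hy2
    have hlt : ‖d‖ < σ₀ * d 0 + σ₁ * d 1 := lt_of_mul_lt_mul_left hy2 hs2.le
    have hn0 : |d 0| ≤ ‖d‖ := PiLp.norm_apply_le d 0
    have hn1 : |d 1| ≤ ‖d‖ := PiLp.norm_apply_le d 1
    have habs : ∀ {σ t : ℝ}, σ ^ 2 = 1 → σ * t ≤ |t| := fun {σ t} hσ => by
      rcases mul_self_eq_one_iff.1 ((pow_two σ).symm.trans hσ) with h | h <;> rw [h]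
      · rw [one_mul]; exact le_abs_self t
      · rw [neg_one_mul]; exact neg_le_abs t
    have hp0 : 0 < σ₀ * d 0 := by linarith [habs hσ₁ (t := d 1)]
    have hp1 : 0 < σ₁ * d 1 := by linarith [habs hσ₀ (t := d 0)]
    have e0 : x 0 + d 0 = y 0 := by simp [hd]
    have e1 : x 1 + d 1 = y 1 := by simp [hd]
    exact ⟨e0 ▸ h₀ (d 0) A hxr.1 hRA (hn0.trans_lt hy1) hp0,
      e1 ▸ h₁ (d 1) B hxr.2 hRB (hn1.trans_lt hy1) hp1⟩

theorem le_hausdorffAsymmetry_rect {A B : ℝ} (hA : 0 ≤ A) (hB : 0 ≤ B)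
    (hvol : volume (rect A B) = ENNReal.ofReal Real.pi) :
    ENNReal.ofReal (A - 1) ≤ hausdorffAsymmetry (rect A B) := by
  rw [hausdorffAsymmetry_eq hvol]
  refine le_iInf fun z => ?_
  by_contra! hlt
  have hpos : 0 < A - 1 := ENNReal.ofReal_pos.1 (bot_le.trans_lt hlt)
  have key : ∀ x ∈ rect A B, dist x z < A := fun x hx => by
    obtain ⟨y, hy, hxy⟩ := exists_edist_lt_of_hausdorffEDist_lt hx hlt
    rw [edist_dist, ENNReal.ofReal_lt_ofReal_iff hpos] at hxy
    linarith [dist_triangle x y z, mem_closedBall.1 hy]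
  -- the two ends of the long axis are at distance `2 A`
  have h1 := key !₂[A, 0] (by simp [rect, abs_of_nonneg hA, hB])
  have h2 := key !₂[-A, 0] (by simp [rect, abs_of_nonneg hA, hB])
  have h3 : 2 * A ≤ dist (!₂[A, 0] : Plane) !₂[-A, 0] := by
    rw [dist_eq_norm]
    refine le_trans (le_of_eq ?_) (PiLp.norm_apply_le _ (0 : Fin 2))
    simp [← two_mul, abs_of_nonneg hA]
  linarith [dist_triangle_right (!₂[A, 0] : Plane) !₂[-A, 0] z]

/-- Half the short side of the comparison rectangle, whose long side is `2000`. -/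
noncomputable def thinHalfSide : ℝ := Real.pi / 4000

theorem volume_thin_rect : volume (rect 1000 thinHalfSide) = ENNReal.ofReal Real.pi := by
  rw [volume_rect, ← ENNReal.ofReal_mul (by norm_num), thinHalfSide]
  congr 1
  ring

theorem thin_rect_mem {R : ℝ} (hR : R ≤ thinHalfSide) :
    rect 1000 thinHalfSide ∈ convexConeClass R := by
  refine mem_convexConeClass_iff.2 ⟨isClosed_rect _ _, convex_rect _ _, volume_thin_rect,
    interiorCone_rect (hR.trans ?_) hR⟩
  rw [thinHalfSide]
  linarith [Real.pi_le_four]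

theorem not_isBall_thin_rect : ¬ IsBall (rect 1000 thinHalfSide) := by
  intro h
  have h1 := le_hausdorffAsymmetry_rect (A := 1000) (by norm_num)
    (by rw [thinHalfSide]; positivity) volume_thin_rect
  rw [hausdorffAsymmetry_eq_zero_of_isBall volume_thin_rect h, nonpos_iff_eq_zero,
    ENNReal.ofReal_eq_zero] at h1
  norm_num at h1

theorem shapeFunctional_thin_rect_le :
    shapeFunctional (rect 1000 thinHalfSide) ≤ ((1 / 625 : ℝ) : EReal) := by
  have hB : 0 < thinHalfSide := by rw [thinHalfSide]; positivity
  have hB1 : thinHalfSide ≤ 1 := by rw [thinHalfSide]; linarith [Real.pi_le_four]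
  obtain ⟨l, hl0, hl⟩ := exists_asymmetry_eq_ofReal hB (thin_rect_mem le_rfl) not_isBall_thin_rect
  rw [shapeFunctional_le_iff volume_thin_rect hl0 hl (by norm_num)]
  refine (perimeter_rect_le (by norm_num) hB.le).trans (ENNReal.ofReal_le_ofReal ?_)
  have h1 := le_hausdorffAsymmetry_rect (A := 1000) (by norm_num) hB.le volume_thin_rect
  rw [hl, ENNReal.ofReal_le_ofReal_iff hl0.le] at h1
  have h2 : (999 : ℝ) ^ 2 ≤ l ^ 2 := by gcongr; linarith
  nlinarith [Real.pi_gt_three]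

end ConeIsop

/-! ### Existence of an optimal set -/

theorem mainTheorem1 :
    ∃ Rbar : ℝ, 0 < Rbar ∧ ∀ R : ℝ, 0 < R → R < Rbar →
      ∃ E₀ : Set ConeIsop.Plane,
        E₀ ∈ ConeIsop.convexConeClass R ∧ ¬ ConeIsop.IsBall E₀ ∧
          ∀ E : Set ConeIsop.Plane,
            E ∈ ConeIsop.convexConeClass R → ¬ ConeIsop.IsBall E →
              ConeIsop.shapeFunctional E₀ ≤ ConeIsop.shapeFunctional E := by
  open ConeIsop Filter Topology in
  refine ⟨thinHalfSide, by rw [thinHalfSide]; positivity, fun R hR hRB => ?_⟩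
  have hthin := thin_rect_mem hRB.le
  set S : Set ℝ := {c | 0 ≤ c ∧ ∃ E ∈ convexConeClass R, ¬ IsBall E ∧
    shapeFunctional E ≤ (c : EReal)} with hS
  have hSbdd : BddBelow S := ⟨0, fun c hc => hc.1⟩
  have hthinS : (1 / 625 : ℝ) ∈ S :=
    ⟨by norm_num, _, hthin, not_isBall_thin_rect, shapeFunctional_thin_rect_le⟩
  set c₀ := sInf S with hc₀
  have hc₀0 : 0 ≤ c₀ := le_csInf ⟨_, hthinS⟩ fun c hc => hc.1
  -- `c₀` is the infimum of the functional, which takes values in `[0, ∞]`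
  have hlow : ∀ E, E ∈ convexConeClass R → ¬ IsBall E → (c₀ : EReal) ≤ shapeFunctional E := by
    intro E hE hball
    have h0 := shapeFunctional_nonneg hR hE hball
    by_contra! hlt
    have htop : shapeFunctional E ≠ ⊤ := (hlt.trans_le le_top).ne
    have hbot : shapeFunctional E ≠ ⊥ := fun h => by simp [h] at h0
    lift shapeFunctional E to ℝ using ⟨htop, hbot⟩ with c hc
    have hcS : c ∈ S := ⟨by exact_mod_cast h0, E, hE, hball, hc.ge⟩
    exact absurd (csInf_le hSbdd hcS) (not_le.2 (by exact_mod_cast hlt))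
  suffices h : ∃ E₀ ∈ convexConeClass R, ¬ IsBall E₀ ∧ shapeFunctional E₀ ≤ (c₀ : EReal) by
    obtain ⟨E₀, h1, h2, h3⟩ := h
    exact ⟨E₀, h1, h2, fun E hE hball => h3.trans (hlow E hE hball)⟩
  rcases (csInf_le hSbdd hthinS).eq_or_lt with heq | hlt
  · refine ⟨_, hthin, not_isBall_thin_rect, ?_⟩
    rw [hc₀, heq]
    exact shapeFunctional_thin_rect_le
  obtain ⟨u, -, hulim, huS⟩ := exists_seq_tendsto_sInf ⟨_, hthinS⟩ hSbdd
  -- discard the terms above `1 / 625`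
  obtain ⟨N, hN⟩ := eventually_atTop.1 (hulim.eventually (gt_mem_nhds hlt))
  have hvlim := hulim.comp (tendsto_add_atTop_nat N)
  choose E hE hball hF using fun n => (huS (n + N)).2
  have hone : ∀ n, 1 ≤ hausdorffAsymmetry (E n) := fun n =>
    one_le_asymmetry_of_shapeFunctional_le hR (hE n) (hball n) (huS (n + N)).1
      (hN _ (Nat.le_add_left _ _)) (hF n)
  obtain ⟨K, hK, φ, hφ, hlam, hper⟩ := exists_limit_mem_convexConeClass hR hE
  have hvK := (mem_convexConeClass_iff.1 hK).2.2.1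
  have hKone : 1 ≤ hausdorffAsymmetry K := ge_of_tendsto' hlam fun n => hone _
  have hKball : ¬ IsBall K := fun h => by
    rw [hausdorffAsymmetry_eq_zero_of_isBall hvK h] at hKone
    simp at hKone
  refine ⟨K, hK, hKball, ?_⟩
  obtain ⟨l, hl0, hl⟩ := exists_asymmetry_eq_ofReal hR hK hKball
  rw [shapeFunctional_le_iff hvK hl0 hl hc₀0]
  choose m hm0 hm using fun n => exists_asymmetry_eq_ofReal hR (hE n) (hball n)
  have hmlim : Tendsto (fun n => m (φ n)) atTop (𝓝 l) := by
    have h1 := (ENNReal.tendsto_toReal (by rw [hl]; exact ENNReal.ofReal_ne_top)).comp hlam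
    simp only [hl, ENNReal.toReal_ofReal hl0.le] at h1
    refine h1.congr fun n => ?_
    simp only [Function.comp, hm, ENNReal.toReal_ofReal (hm0 _).le]
  refine hper (fun n => ENNReal.ofReal (2 * Real.pi * (1 + u (φ n + N) * m (φ n) ^ 2))) _ ?_
    fun n => ?_
  · refine ENNReal.tendsto_ofReal (Tendsto.const_mul _ (tendsto_const_nhds.add ?_))
    exact (hvlim.comp hφ.tendsto_atTop).mul (hmlim.pow 2)
  · exact (shapeFunctional_le_iff (mem_convexConeClass_iff.1 (hE _)).2.2.1 (hm0 _) (hm _)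
      (huS _).1).1 (hF _)
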